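/- **Theorem 2.1.** Let $1<p<N$, let $\Omega\subset\mathbb R^N$ be an arbitrary (not necessarily bounded) domain, and let $D^{1,p}(\Omega)$ be the completion of $C_c^\infty(\Omega)$ under the norm $\left(\int_\Omega|\nabla u|^p\,dx\right)^{1/p}$, regarded as a space of functions in $L^{p^*}(\Omega)$, $p^*=\frac{Np}{N-p}$, with weak gradients in $L^p(\Omega)$. Let $\mathcal A:\Omega\times\mathbb R\times\mathbb R^N\to\mathbb R^N$ and $\mathcal B:\Omega\times\mathbb R\times\mathbb R^N\to\mathbb R$ be Carathéodory functions (Lebesgue measurable in $x$, continuous in $(\zeta,\xi)$) such that, with a constant $\lambda>0$ and nonnegative functions $a_1,a_2,b_1,b_2,b_3$ on $\Omega$, for almost every $x\in\Omega$ and all $(\zeta,\xi)\in\mathbb R\times\mathbb R^N$, $$\mathcal A(x,\zeta,\xi)\cdot\xi\ \ge\ \lambda|\xi|^p-a_1(x)|\zeta|^p-a_2(x),\qquad |\mathcal B(x,\zeta,\xi)|\ \le\ b_1(x)|\xi|^{p-1}+b_2(x)|\zeta|^{p-1}+b_3(x).$$ Let $u\in D^{1,p}(\Omega)$ be a weak solution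 of $-\mathrm{div}\,\mathcal A(x,u,\nabla u)=\mathcal B(x,u,\nabla u)$ in $\Omega$, that is, for every $\varphi\in D^{1,p}(\Omega)$ the functions $\mathcal A(x,u,\nabla u)\cdot\nabla\varphi$ and $\mathcal B(x,u,\nabla u)\varphi$ are integrable on $\Omega$ and $$\int_\Omega\mathcal A(x,u,\nabla u)\cdot\nabla\varphi\,dx=\int_\Omega\mathcal B(x,u,\nabla u)\,\varphi\,dx .$$ Write $|\cdot|_r$ for the norm of $L^r(\Omega)$. Assume that $b_1\in L^\infty(\Omega)$, that $a_1,b_2\in L^{q/p}(\Omega)$ for some $q>N$, and that, for some $\beta>p$, $u\in L^\beta(\Omega)$, $a_2\in L^{\beta/p}(\Omega)\cap L^\infty(\Omega)$ and $b_3\in L^{\beta/(p-1)}(\Omega)\cap L^\infty(\Omega)$. Then there is $\theta_0=\theta_0(p,\beta,N)$ with $0<\theta_0\le1$ such that $$|u|_\infty\ \le\ C\,\max\{|u|_\beta,\ |u|_\beta^{\theta_0}\},$$ where, for given $p,q,\beta,N,\lambda$, the finite constant $C$ depends only on, and is nondecreasing in, the norms $|b_1|_\infty$, $|a_1|_{q/p}$,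 $|b_2|_{q/p}$, $|a_2|_{\beta/p}+|a_2|_\infty$ and $|b_3|_{\beta/(p-1)}+|b_3|_\infty$. In particular, $\theta_0$ and $C$ do not depend on $\Omega$, $\mathcal A$, $\mathcal B$ or $u$ otherwise. -/

import Mathlib

open MeasureTheory Filter Topology
open scoped NNReal ENNReal ContDiff

namespace Quasilinear

/-- The space `ℝ^N` with its Euclidean norm. -/
abbrev Space (N : ℕ) : Type := EuclideanSpace ℝ (Fin N)

/-- A domain: a nonempty, open, connected set, not necessarily bounded. -/
def IsDomainSet {N : ℕ} (Ω : Set (Space N)) : Prop :=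
  IsOpen Ω ∧ IsConnected Ω

/-- `φ ∈ C_c^∞(Ω)`. -/
def IsTestFunction {N : ℕ} (Ω : Set (Space N)) (φ : Space N → ℝ) : Prop :=
  ContDiff ℝ ∞ φ ∧ HasCompactSupport φ ∧ tsupport φ ⊆ Ω

/-- The critical Sobolev exponent `p* = N p / (N - p)` (used for `1 < p < N` only). -/
noncomputable def criticalExponent (N : ℕ) (p : ℝ) : ℝ :=
  (N : ℝ) * p / ((N : ℝ) - p)

/-- `u ∈ D^{1,p}(Ω)` with (weak) gradient `∇u = g`, for `1 < p < N`.

`D^{1,p}(Ω)` is the completion of `C_c^∞(Ω)` under `‖φ‖ = (∫_Ω |∇φ|^p)^{1/p}`. By the Sobolev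
inequality a Cauchy sequence for this norm is also Cauchy in `L^{p*}(Ω)`, and so the completion is
the space of those `u ∈ L^{p*}(Ω)` that are limits in `L^{p*}(Ω)` of test functions whose
gradients converge in `L^p(Ω)`; the limit `g` of the gradients is the weak gradient of `u`,
and is determined by `u` almost everywhere on `Ω`. -/
def IsBeppoLevi {N : ℕ} (Ω : Set (Space N)) (p : ℝ)
    (u : Space N → ℝ) (g : Space N → Space N) : Prop :=
  MemLp u (ENNReal.ofReal (criticalExponent N p)) (volume.restrict Ω) ∧
  MemLp g (ENNReal.ofReal p) (volume.restrict Ω) ∧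
  ∃ φ : ℕ → Space N → ℝ,
    (∀ n, IsTestFunction Ω (φ n)) ∧
    Tendsto (fun n => eLpNorm (fun x => φ n x - u x)
      (ENNReal.ofReal (criticalExponent N p)) (volume.restrict Ω)) atTop (𝓝 0) ∧
    Tendsto (fun n => eLpNorm (fun x => gradient (φ n) x - g x)
      (ENNReal.ofReal p) (volume.restrict Ω)) atTop (𝓝 0)

/-- Carathéodory functions of `(x, ζ, ξ) ∈ Ω × ℝ × ℝ^N`: Lebesgue measurable in `x ∈ Ω` for all
`(ζ, ξ)`, and continuous in `(ζ, ξ)` for almost every `x ∈ Ω`. -/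
def IsCaratheodory {N : ℕ} {F : Type*} [TopologicalSpace F] [MeasurableSpace F]
    (Ω : Set (Space N)) (f : Space N → ℝ → Space N → F) : Prop :=
  (∀ (ζ : ℝ) (ξ : Space N), AEMeasurable (fun x => f x ζ ξ) (volume.restrict Ω)) ∧
  ∀ᵐ x ∂(volume.restrict Ω), Continuous (fun z : ℝ × Space N => f x z.1 z.2)

/-- The structure conditions on `Ω`, with nonnegative data functions:
`A(x, ζ, ξ) · ξ ≥ λ |ξ|^p - a₁(x) |ζ|^p - a₂(x)` and
`|B(x, ζ, ξ)| ≤ b₁(x) |ξ|^{p-1} + b₂(x) |ζ|^{p-1} + b₃(x)`. -/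
structure StructureConditions {N : ℕ} (Ω : Set (Space N)) (p lam : ℝ)
    (A : Space N → ℝ → Space N → Space N) (B : Space N → ℝ → Space N → ℝ)
    (a₁ a₂ b₁ b₂ b₃ : Space N → ℝ) : Prop where
  nonneg : ∀ᵐ x ∂(volume.restrict Ω),
    0 ≤ a₁ x ∧ 0 ≤ a₂ x ∧ 0 ≤ b₁ x ∧ 0 ≤ b₂ x ∧ 0 ≤ b₃ x
  s1 : ∀ᵐ x ∂(volume.restrict Ω), ∀ (ζ : ℝ) (ξ : Space N),
    lam * ‖ξ‖ ^ p - a₁ x * |ζ| ^ p - a₂ x ≤ inner ℝ (A x ζ ξ) ξ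
  s2 : ∀ᵐ x ∂(volume.restrict Ω), ∀ (ζ : ℝ) (ξ : Space N),
    |B x ζ ξ| ≤ b₁ x * ‖ξ‖ ^ (p - 1) + b₂ x * |ζ| ^ (p - 1) + b₃ x

/-- `u ∈ D^{1,p}(Ω)`, with `∇u = g`, is a weak solution of `-div A(x, u, ∇u) = B(x, u, ∇u)`:
for every `φ ∈ D^{1,p}(Ω)` both integrals below exist, and
`∫_Ω A(x, u, ∇u) · ∇φ = ∫_Ω B(x, u, ∇u) φ`. -/
def IsWeakSolution {N : ℕ} (Ω : Set (Space N)) (p : ℝ)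
    (A : Space N → ℝ → Space N → Space N) (B : Space N → ℝ → Space N → ℝ)
    (u : Space N → ℝ) (g : Space N → Space N) : Prop :=
  IsBeppoLevi Ω p u g ∧
  ∀ (φ : Space N → ℝ) (ψ : Space N → Space N), IsBeppoLevi Ω p φ ψ →
    Integrable (fun x => inner ℝ (A x (u x) (g x)) (ψ x)) (volume.restrict Ω) ∧
    Integrable (fun x => B x (u x) (g x) * φ x) (volume.restrict Ω) ∧
    ∫ x in Ω, inner ℝ (A x (u x) (g x)) (ψ x) = ∫ x in Ω, B x (u x) (g x) * φ x

/-- The norm `|f|_{r,Ω}` of `L^r(Ω)`, with values in `[0, ∞]`. -/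
noncomputable def normOn {N : ℕ} (Ω : Set (Space N)) (r : ℝ≥0∞) (f : Space N → ℝ) : ℝ≥0∞ :=
  eLpNorm f r (volume.restrict Ω)

/-- The norm `|f|_{r,Ω} + |f|_{∞,Ω}` of `L^r(Ω) ∩ L^∞(Ω)`. -/
noncomputable def interNormOn {N : ℕ} (Ω : Set (Space N)) (r : ℝ≥0∞) (f : Space N → ℝ) : ℝ≥0∞ :=
  normOn Ω r f + normOn Ω ∞ f

end Quasilinear

/-!
The proof is Moser's iteration, carried out globally. Since `A` satisfies no upper bound, cut-off
functions are not available, and the equation is tested with functions of `u` only.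

For `r ≥ β` and a truncation level `k`, put `s = r - p` and `G(t) = min(|t|, k) ^ s`. As `s > 0`,
`G` is bounded and uniformly continuous, so the primitive `F` of `G` gives an admissible test
function `F(u)` (`IsBeppoLevi.comp`: `F` is approximated by smooth functions, which map test
functions to test functions). Because `|F(t)| ≤ |t| G(t)`, coercivity and Young's inequality give
(`lintegral_energy_le`)
`(λ/2) ∫ |∇u|^p G(u) ≤ ∫ ((a₁ + b₂) |u|^p + C |u|^p + a₂ + b₃ |u|) G(u)`.
The left-hand side is a multiple of `‖∇H(u)‖_p^p`, where `H` is the primitive of `G^{1/p}`. The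
Sobolev inequality on `D^{1,p}(Ω)` (`exists_sobolev`) then bounds the `L^{p*}` norm of
`W = |u| G(u)^{1/p}`, which is comparable to `H(u)`. The term with `a₁ + b₂` is interpolated
between `‖W‖_p` and `‖W‖_{p*}` and absorbed, which is possible as `q > N`. The terms with `a₂`
and `b₃` are estimated by Hölder's inequality; this is where the lower powers `|u|_r^{r-p}` and
`|u|_r^{r-p+1}` arise. Letting `k → ∞` (`moser_step`, `eLpNorm_le_stepConst_mul`), with
`χ = N / (N - p)` and `κ = p / (1 - N / q)`,
`|u|_{χ r} ≤ (M r^κ)^{1/r} max(|u|_r, |u|_r^{1 - p/r})`.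

This is iterated along `r = β χ ^ j` (`moser_recursion`). The constants multiply up to a finite one
because `∑ (1 + j) / (β χ ^ j)` converges, and by Bernoulli's inequality the product of the
exponents `1 - p / (β χ ^ j)` is at least `(1 - p / β) ^ (1 / (1 - χ⁻¹)) = (1 - p / β) ^ (N / p)`,
which is the exponent `θ₀`. A uniform bound of the `L^r` norms as `r → ∞` bounds the `L^∞` norm.
-/

/-! ### The Sobolev inequality and the chain rule in `D^{1,p}(Ω)` -/

namespace Quasilinear

variable {N : ℕ} {Ω : Set (Space N)} {p : ℝ} {u : Space N → ℝ} {g : Space N → Space N}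

theorem abs_sub_le_of_hasDerivAt {f f' : ℝ → ℝ} {C : ℝ} (hf : ∀ t, HasDerivAt f (f' t) t)
    (hC : ∀ t, |f' t| ≤ C) (a b : ℝ) : |f a - f b| ≤ C * |a - b| := by
  simpa [Real.norm_eq_abs] using Convex.norm_image_sub_le_of_norm_hasDerivWithin_le
    (s := Set.univ) (x := b) (y := a) (fun x _ => (hf x).hasDerivWithinAt) (fun x _ => hC x)
    convex_univ trivial trivial

theorem norm_gradient (f : Space N → ℝ) (x : Space N) : ‖gradient f x‖ = ‖fderiv ℝ f x‖ := by
  simp [gradient]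

theorem gradient_comp {F : ℝ → ℝ} {F' : ℝ} {φ : Space N → ℝ} {x : Space N}
    (hF : HasDerivAt F F' (φ x)) (hφ : DifferentiableAt ℝ φ x) :
    gradient (fun y => F (φ y)) x = F' • gradient φ x := by
  have h := (hF.comp_hasFDerivAt x hφ.hasFDerivAt).fderiv
  simp only [gradient]
  rw [show (fun y => F (φ y)) = F ∘ φ from rfl, h]
  simp

theorem continuous_gradient {φ : Space N → ℝ} (hφ : ContDiff ℝ ∞ φ) :
    Continuous (gradient φ) := by
  unfold gradient
  exact (LinearIsometryEquiv.continuous _).comp (hφ.continuous_fderiv (by simp))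

theorem criticalExponent_inv (hp : 1 < p) (hpN : p < N) :
    (criticalExponent N p)⁻¹ = p⁻¹ - (N : ℝ)⁻¹ := by
  have : (0 : ℝ) < N := by linarith
  unfold criticalExponent
  field_simp

theorem one_lt_criticalExponent (hp : 1 < p) (hpN : p < N) : 1 < criticalExponent N p := by
  unfold criticalExponent
  rw [one_lt_div (by linarith)]
  nlinarith

/-- The Sobolev inequality for test functions. The constant depends on `N` and `p` only, because
test functions on `Ω` are test functions on the whole space. -/
theorem exists_sobolev_testFunction (hp : 1 < p) (hpN : p < N) :
    ∃ S : ℝ≥0, ∀ (Ω : Set (Space N)) (φ : Space N → ℝ), IsTestFunction Ω φ →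
      eLpNorm φ (ENNReal.ofReal (criticalExponent N p)) (volume.restrict Ω) ≤
        S * eLpNorm (gradient φ) (ENNReal.ofReal p) (volume.restrict Ω) := by
  refine ⟨SNormLESNormFDerivOfEqConst ℝ (volume : Measure (Space N)) p, fun Ω φ hφ => ?_⟩
  have h1 : Function.support φ ⊆ Ω := (subset_tsupport φ).trans hφ.2.2
  have h2 : Function.support (gradient φ) ⊆ Ω := by
    refine subset_trans ?_ ((tsupport_fderiv_subset ℝ (f := φ)).trans hφ.2.2)
    refine subset_trans (fun x hx => ?_) (subset_tsupport _)
    simp only [Function.mem_support] at hx ⊢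
    contrapose! hx
    rw [← norm_eq_zero, norm_gradient, hx, norm_zero]
  rw [eLpNorm_restrict_eq_of_support_subset h1, eLpNorm_restrict_eq_of_support_subset h2]
  have := eLpNorm_le_eLpNorm_fderiv_of_eq (volume : Measure (Space N))
    (p := p.toNNReal) (p' := (criticalExponent N p).toNNReal) (hφ.1.of_le (by simp)) hφ.2.1
    (by simpa using hp.le) (by
      rw [finrank_euclideanSpace_fin]
      exact_mod_cast (by linarith : (0 : ℝ) < N))
    (by
      rw [finrank_euclideanSpace_fin, NNReal.coe_inv, Real.coe_toNNReal p (by linarith),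
        Real.coe_toNNReal _ (zero_le_one.trans (one_lt_criticalExponent hp hpN).le),
        criticalExponent_inv hp hpN])
  rw [Real.coe_toNNReal _ (by linarith)] at this
  refine this.trans_eq ?_
  congr 1
  exact eLpNorm_congr_norm_ae (Eventually.of_forall fun x => (norm_gradient φ x).symm)

/-- The Sobolev inequality on `D^{1,p}(Ω)`, by density of the test functions. -/
theorem exists_sobolev (hp : 1 < p) (hpN : p < N) :
    ∃ S : ℝ≥0, ∀ (Ω : Set (Space N)) (u : Space N → ℝ) (g : Space N → Space N),
      IsBeppoLevi Ω p u g →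
      eLpNorm u (ENNReal.ofReal (criticalExponent N p)) (volume.restrict Ω) ≤
        S * eLpNorm g (ENNReal.ofReal p) (volume.restrict Ω) := by
  obtain ⟨S, hS⟩ := exists_sobolev_testFunction hp hpN
  refine ⟨S, fun Ω u g ⟨hu, hg, φ, hφ, h1, h2⟩ => ?_⟩
  have hp1 : 1 ≤ ENNReal.ofReal p := by simpa using hp.le
  have hq1 : 1 ≤ ENNReal.ofReal (criticalExponent N p) := by
    simpa using (one_lt_criticalExponent hp hpN).le
  have key : ∀ n, eLpNorm u (ENNReal.ofReal (criticalExponent N p)) (volume.restrict Ω) ≤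
      eLpNorm (fun x => φ n x - u x)
        (ENNReal.ofReal (criticalExponent N p)) (volume.restrict Ω) +
      S * (eLpNorm (fun x => gradient (φ n) x - g x)
        (ENNReal.ofReal p) (volume.restrict Ω) +
        eLpNorm g (ENNReal.ofReal p) (volume.restrict Ω)) := by
    intro n
    have m1 : AEStronglyMeasurable (φ n) (volume.restrict Ω) :=
      (hφ n).1.continuous.aestronglyMeasurable
    have m2 : AEStronglyMeasurable (gradient (φ n)) (volume.restrict Ω) :=
      (continuous_gradient (hφ n).1).aestronglyMeasurable
    have e1 := eLpNorm_sub_le m1 (m1.sub hu.1) hq1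
    have e2 := eLpNorm_add_le (m2.sub hg.1) hg.1 hp1
    rw [sub_add_cancel] at e2
    rw [sub_sub_cancel, add_comm] at e1
    refine e1.trans (add_le_add le_rfl ((hS Ω _ (hφ n)).trans ?_))
    gcongr
    exact e2
  refine ge_of_tendsto' (x := atTop) ?_ key
  have := h1.add (ENNReal.Tendsto.const_mul (h2.add_const
    (eLpNorm g (ENNReal.ofReal p) (volume.restrict Ω))) (a := (S : ℝ≥0∞))
    (Or.inr ENNReal.coe_ne_top))
  simpa using this

/-- Dominated convergence for `L^P` norms. -/
theorem tendsto_eLpNorm_zero_of_dominated {X E : Type*} [MeasurableSpace X] [NormedAddCommGroup E]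
    {μ : Measure X} {P : ℝ} (hP : 0 < P) {f : ℕ → X → E} {h : X → E}
    (hf : ∀ n, AEStronglyMeasurable (f n) μ) (hh : MemLp h (ENNReal.ofReal P) μ)
    {L : ℝ≥0} (hfh : ∀ n, ∀ᵐ x ∂μ, ‖f n x‖ₑ ≤ L * ‖h x‖ₑ)
    (hlim : ∀ᵐ x ∂μ, Tendsto (fun n => f n x) atTop (𝓝 0)) :
    Tendsto (fun n => eLpNorm (f n) (ENNReal.ofReal P) μ) atTop (𝓝 0) := by
  have hP0 : ENNReal.ofReal P ≠ 0 := by simpa using hP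
  simp only [eLpNorm_eq_lintegral_rpow_enorm_toReal hP0 ENNReal.ofReal_ne_top,
    ENNReal.toReal_ofReal hP.le]
  have hfin : ∫⁻ x, (L * ‖h x‖ₑ) ^ P ∂μ ≠ ⊤ := by
    have := lintegral_rpow_enorm_lt_top_of_eLpNorm_lt_top hP0 ENNReal.ofReal_ne_top hh.2
    rw [ENNReal.toReal_ofReal hP.le] at this
    simp_rw [ENNReal.mul_rpow_of_nonneg _ _ hP.le]
    rw [lintegral_const_mul' _ _ (by finiteness)]
    exact ENNReal.mul_ne_top (by finiteness) this.ne
  have := tendsto_lintegral_of_dominated_convergence' (μ := μ) (F := fun n x => ‖f n x‖ₑ ^ P)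
    (f := fun _ => 0) (fun x => (L * ‖h x‖ₑ) ^ P) (fun n => (hf n).enorm.pow_const P)
    (fun n => (hfh n).mono fun x hx => ENNReal.rpow_le_rpow hx hP.le) hfin
    (hlim.mono fun x hx => by
      have := ((ENNReal.continuous_rpow_const (y := P)).tendsto _).comp hx.enorm
      simpa [hP, Function.comp_def] using this)
  have h2 := ((ENNReal.continuous_rpow_const (y := 1 / P)).tendsto _).comp this
  simpa [hP, Function.comp_def] using h2

/-- A bounded, uniformly continuous function is the uniform limit of bounded smooth functions, so
its primitive is the limit of smooth primitives with uniformly close derivatives. -/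
theorem exists_smooth_primitive {F G : ℝ → ℝ} (hF : ∀ t, HasDerivAt F (G t) t) (hF0 : F 0 = 0)
    (hG : UniformContinuous G) {ε : ℝ} (hε : 0 < ε) :
    ∃ F' G' : ℝ → ℝ, ContDiff ℝ ∞ F' ∧ Continuous G' ∧ (∀ t, HasDerivAt F' (G' t) t) ∧ F' 0 = 0 ∧
      (∀ t, |G' t - G t| ≤ ε) ∧ ∀ t, |F' t - F t| ≤ ε * |t| := by
  obtain ⟨G', hG', hd⟩ := hG.exists_contDiff_dist_le hε
  have hder : ∀ t, HasDerivAt (fun t => ∫ τ in (0 : ℝ)..t, G' τ) (G' t) t := fun t =>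
    intervalIntegral.integral_hasDerivAt_right (hG'.continuous.intervalIntegrable _ _)
      (hG'.continuous.stronglyMeasurableAtFilter _ _) hG'.continuous.continuousAt
  have hd' : ∀ t, |G' t - G t| ≤ ε := fun t => (hd t).le
  refine ⟨fun t => ∫ τ in (0 : ℝ)..t, G' τ, G', ?_, hG'.continuous, hder, by simp, hd',
    fun t => ?_⟩
  · rw [contDiff_infty_iff_deriv]
    exact ⟨fun t => (hder t).differentiableAt, by rwa [funext fun t => (hder t).deriv]⟩
  · have := abs_sub_le_of_hasDerivAt (fun t => (hder t).sub (hF t)) hd' t 0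
    simpa [hF0] using this

/-- The chain rule in `D^{1,p}(Ω)`: if `F` has the bounded, uniformly continuous derivative `G`
and `F 0 = 0`, then `F(u) ∈ D^{1,p}(Ω)` with `∇F(u) = G(u) ∇u`. -/
theorem IsBeppoLevi.comp (hp : 1 < p) (hpN : p < N) (h : IsBeppoLevi Ω p u g) {F G : ℝ → ℝ}
    (hF : ∀ t, HasDerivAt F (G t) t) (hF0 : F 0 = 0) (hG : UniformContinuous G) {L : ℝ}
    (hL : ∀ t, |G t| ≤ L) :
    IsBeppoLevi Ω p (fun x => F (u x)) (fun x => G (u x) • g x) := by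
  obtain ⟨hu, hg, φ, hφ, h1, h2⟩ := h
  have hp0 : 0 < p := by linarith
  have hp1 : 1 ≤ ENNReal.ofReal p := by simpa using hp.le
  have hq1 : 1 ≤ ENNReal.ofReal (criticalExponent N p) := by
    simpa using (one_lt_criticalExponent hp hpN).le
  have hFc : Continuous F := continuous_iff_continuousAt.2 fun t => (hF t).continuousAt
  have hL0 : 0 ≤ L := (abs_nonneg _).trans (hL 0)
  have hFL : ∀ t, |F t| ≤ L * |t| := fun t => by
    simpa [hF0] using abs_sub_le_of_hasDerivAt hF hL t 0
  have mF : AEStronglyMeasurable (fun x => F (u x)) (volume.restrict Ω) :=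
    hFc.comp_aestronglyMeasurable hu.1
  have mG : AEStronglyMeasurable (fun x => G (u x) • g x) (volume.restrict Ω) :=
    (hG.continuous.comp_aestronglyMeasurable hu.1).smul hg.1
  refine ⟨hu.of_le_mul mF (Eventually.of_forall fun x => hFL _),
    hg.of_le_mul mG (c := L) (Eventually.of_forall fun x => ?_), ?_⟩
  · rw [norm_smul]
    exact mul_le_mul_of_nonneg_right (hL _) (norm_nonneg _)
  -- Along a subsequence the test functions converge almost everywhere.
  obtain ⟨ns, hns, hae⟩ := (tendstoInMeasure_of_tendsto_eLpNorm
    (zero_lt_one.trans_le hq1).ne' (fun n => (hφ n).1.continuous.aestronglyMeasurable) hu.1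
    h1).exists_seq_tendsto_ae
  set ε : ℕ → ℝ := fun n => 1 / ((n : ℝ) + 1) with hε
  have hε0 : ∀ n, 0 < ε n := fun n => by positivity
  have hε1 : ∀ n, ε n ≤ 1 := fun n => by
    rw [hε]; simp only; rw [div_le_one (by positivity)]; linarith [n.cast_nonneg (α := ℝ)]
  have hεlim : Tendsto (fun n => ENNReal.ofReal (ε n)) atTop (𝓝 0) := by
    simpa [hε] using ENNReal.tendsto_ofReal (tendsto_one_div_add_atTop_nhds_zero_nat (𝕜 := ℝ))
  choose F' G' cF' cG' dF' zF' hG' hF' using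
    fun n => exists_smooth_primitive hF hF0 hG (hε0 n)
  have hG'L : ∀ n t, |G' n t| ≤ L + 1 := fun n t => by
    have h1 := abs_sub_abs_le_abs_sub (G' n t) (G t)
    linarith [hG' n t, hL t, hε1 n]
  have hgrad : ∀ n x, gradient (fun y => F' n (φ (ns n) y)) x =
      G' n (φ (ns n) x) • gradient (φ (ns n)) x := fun n x =>
    gradient_comp (dF' n _) ((hφ _).1.differentiable (by simp) x)
  refine ⟨fun n x => F' n (φ (ns n) x), fun n => ⟨(cF' n).comp (hφ _).1, ?_, ?_⟩, ?_, ?_⟩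
  · exact (hφ _).2.1.comp_left (zF' n)
  · exact (tsupport_comp_subset (zF' n) (φ (ns n))).trans (hφ _).2.2
  · have hb : ∀ n, eLpNorm (fun x => F' n (φ (ns n) x) - F (u x))
        (ENNReal.ofReal (criticalExponent N p)) (volume.restrict Ω) ≤
        ENNReal.ofReal (L + 1) * eLpNorm (fun x => φ (ns n) x - u x)
          (ENNReal.ofReal (criticalExponent N p)) (volume.restrict Ω) +
        ENNReal.ofReal (ε n) * eLpNorm u
          (ENNReal.ofReal (criticalExponent N p)) (volume.restrict Ω) := by
      intro n
      have hFn : Continuous (F' n) := (cF' n).continuous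
      have m1 : AEStronglyMeasurable (fun x => F' n (φ (ns n) x)) (volume.restrict Ω) :=
        (hFn.comp (hφ _).1.continuous).aestronglyMeasurable
      have m2 : AEStronglyMeasurable (fun x => F' n (u x)) (volume.restrict Ω) :=
        hFn.comp_aestronglyMeasurable hu.1
      have e := eLpNorm_add_le (m1.sub m2) (m2.sub mF) hq1
      rw [sub_add_sub_cancel] at e
      refine e.trans (add_le_add ?_ ?_)
      · exact eLpNorm_le_mul_eLpNorm_of_ae_le_mul (Eventually.of_forall fun x =>
          abs_sub_le_of_hasDerivAt (dF' n) (hG'L n) _ _) _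
      · exact eLpNorm_le_mul_eLpNorm_of_ae_le_mul (Eventually.of_forall fun x => hF' n _) _
    refine tendsto_of_tendsto_of_tendsto_of_le_of_le tendsto_const_nhds ?_ (fun _ => zero_le) hb
    have t1 := ENNReal.Tendsto.const_mul (h1.comp hns.tendsto_atTop)
      (a := ENNReal.ofReal (L + 1)) (Or.inr ENNReal.ofReal_ne_top)
    have t2 := ENNReal.Tendsto.mul_const hεlim (b := eLpNorm u
          (ENNReal.ofReal (criticalExponent N p)) (volume.restrict Ω)) (Or.inr hu.2.ne)
    simpa [Function.comp_def] using t1.add t2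
  · simp only [hgrad]
    have hb : ∀ n, eLpNorm (fun x => G' n (φ (ns n) x) • gradient (φ (ns n)) x - G (u x) • g x)
        (ENNReal.ofReal p) (volume.restrict Ω) ≤
        ENNReal.ofReal (L + 1) * eLpNorm (fun x => gradient (φ (ns n)) x - g x)
          (ENNReal.ofReal p) (volume.restrict Ω) +
        (ENNReal.ofReal (ε n) * eLpNorm g (ENNReal.ofReal p) (volume.restrict Ω) +
        eLpNorm (fun x => (G (φ (ns n) x) - G (u x)) • g x)
          (ENNReal.ofReal p) (volume.restrict Ω)) := by
      intro n
      have c1 : Continuous fun x => G' n (φ (ns n) x) := (cG' n).comp (hφ _).1.continuous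
      have c2 : Continuous fun x => G (φ (ns n) x) := hG.continuous.comp (hφ _).1.continuous
      have m1 : AEStronglyMeasurable (fun x => G' n (φ (ns n) x) • gradient (φ (ns n)) x)
          (volume.restrict Ω) :=
        (c1.smul (continuous_gradient (hφ _).1)).aestronglyMeasurable
      have m2 : AEStronglyMeasurable (fun x => G' n (φ (ns n) x) • g x) (volume.restrict Ω) :=
        c1.aestronglyMeasurable.smul hg.1
      have m3 : AEStronglyMeasurable (fun x => G (φ (ns n) x) • g x) (volume.restrict Ω) :=
        c2.aestronglyMeasurable.smul hg.1
      have e := eLpNorm_add_le (m1.sub m2) (m2.sub mG) hp1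
      have e' := eLpNorm_add_le (m2.sub m3) (m3.sub mG) hp1
      rw [sub_add_sub_cancel] at e e'
      refine e.trans (add_le_add ?_ (e'.trans (add_le_add ?_ ?_)))
      · refine eLpNorm_le_mul_eLpNorm_of_ae_le_mul (Eventually.of_forall fun x => ?_) _
        simp only [Pi.sub_apply, ← smul_sub, norm_smul]
        exact mul_le_mul_of_nonneg_right (hG'L n _) (norm_nonneg _)
      · refine eLpNorm_le_mul_eLpNorm_of_ae_le_mul (Eventually.of_forall fun x => ?_) _
        simp only [Pi.sub_apply, ← sub_smul, norm_smul]
        exact mul_le_mul_of_nonneg_right (hG' n _) (norm_nonneg _)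
      · refine (eLpNorm_congr_ae (Eventually.of_forall fun x => ?_)).le
        simp only [Pi.sub_apply, ← sub_smul]
    refine tendsto_of_tendsto_of_tendsto_of_le_of_le tendsto_const_nhds ?_ (fun _ => zero_le) hb
    have t1 := ENNReal.Tendsto.const_mul (h2.comp hns.tendsto_atTop)
      (a := ENNReal.ofReal (L + 1)) (Or.inr ENNReal.ofReal_ne_top)
    have t2 := ENNReal.Tendsto.mul_const hεlim (b := eLpNorm g
          (ENNReal.ofReal p) (volume.restrict Ω)) (Or.inr hg.2.ne)
    have t3 : Tendsto (fun n => eLpNorm (fun x => (G (φ (ns n) x) - G (u x)) • g x)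
          (ENNReal.ofReal p) (volume.restrict Ω)) atTop (𝓝 0) := by
      refine tendsto_eLpNorm_zero_of_dominated hp0 (fun n => ?_) hg (L := (2 * L).toNNReal)
        (fun n => Eventually.of_forall fun x => ?_) (hae.mono fun x hx => ?_)
      · exact ((hG.continuous.comp (hφ _).1.continuous).aestronglyMeasurable.sub
          (hG.continuous.comp_aestronglyMeasurable hu.1)).smul hg.1
      · rw [enorm_smul]
        gcongr
        rw [Real.enorm_eq_ofReal_abs]
        refine ENNReal.ofReal_le_ofReal ((abs_sub _ _).trans ?_)
        linarith [hL (φ (ns n) x), hL (u x)]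
      · have := (((hG.continuous.tendsto _).comp hx).sub_const (G (u x))).smul_const (g x)
        simpa [Function.comp_def] using this
    simpa [Function.comp_def] using t1.add (t2.add t3)

end Quasilinear

/-! ### The energy inequality -/

namespace Quasilinear

variable {N : ℕ} {Ω : Set (Space N)} {p : ℝ} {u : Space N → ℝ} {g : Space N → Space N}

theorem rpow_sub_one_mul_self {X : ℝ} (hp : 1 < p) (hX : 0 ≤ X) : X ^ (p - 1) * X = X ^ p := by
  nth_rw 2 [← Real.rpow_one X]
  rw [← Real.rpow_add_of_nonneg hX (by linarith) zero_le_one, sub_add_cancel]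

/-- Young's inequality with explicit constants. -/
theorem mul_rpow_sub_one_mul_le {l b X t : ℝ} (hp : 1 < p) (hl : 0 < l) (hb : 0 ≤ b) (hX : 0 ≤ X)
    (ht : 0 ≤ t) :
    b * X ^ (p - 1) * t ≤ l / 2 * X ^ p + b * (2 * b / l) ^ (p - 1) * t ^ p := by
  have hX1 : 0 ≤ X ^ (p - 1) := by positivity
  rcases le_total (b * t) (l / 2 * X) with h | h
  · calc b * X ^ (p - 1) * t = X ^ (p - 1) * (b * t) := by ring
      _ ≤ X ^ (p - 1) * (l / 2 * X) := by gcongr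
      _ = l / 2 * X ^ p := by rw [← rpow_sub_one_mul_self hp hX]; ring
      _ ≤ _ := le_add_of_nonneg_right (by positivity)
  · have hXt : X ≤ 2 * b / l * t := by
      rw [div_mul_eq_mul_div, le_div_iff₀ hl]; linarith
    calc b * X ^ (p - 1) * t ≤ b * (2 * b / l * t) ^ (p - 1) * t := by
          gcongr
      _ = b * (2 * b / l) ^ (p - 1) * t ^ p := by
          rw [Real.mul_rpow (by positivity) ht, ← rpow_sub_one_mul_self hp ht]; ring
      _ ≤ _ := le_add_of_nonneg_left (by positivity)

/-- The energy inequality. Testing the equation with `F(u)`, where `F' = G ≥ 0` and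
`|F(t)| ≤ |t| G(t)`, uses neither a growth condition on `A` nor a cut-off function. -/
theorem lintegral_energy_le {lam : ℝ} {A : Space N → ℝ → Space N → Space N}
    {B : Space N → ℝ → Space N → ℝ} {a₁ a₂ b₁ b₂ b₃ : Space N → ℝ}
    (hp : 1 < p) (hpN : p < N) (hlam : 0 < lam)
    (hs : StructureConditions Ω p lam A B a₁ a₂ b₁ b₂ b₃)
    (ma₁ : AEStronglyMeasurable a₁ (volume.restrict Ω))
    (ma₂ : AEStronglyMeasurable a₂ (volume.restrict Ω))
    (mb₂ : AEStronglyMeasurable b₂ (volume.restrict Ω))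
    (mb₃ : AEStronglyMeasurable b₃ (volume.restrict Ω))
    {b : ℝ} (hb0 : 0 ≤ b) (hb : ∀ᵐ x ∂(volume.restrict Ω), b₁ x ≤ b)
    (hu : IsWeakSolution Ω p A B u g) {F G : ℝ → ℝ}
    (hF : ∀ t, HasDerivAt F (G t) t) (hF0 : F 0 = 0) (hG : UniformContinuous G) {L : ℝ}
    (hL : ∀ t, |G t| ≤ L) (hG0 : ∀ t, 0 ≤ G t) (hFG : ∀ t, |F t| ≤ |t| * G t) :
    ∫⁻ x in Ω, ENNReal.ofReal (lam / 2 * (‖g x‖ ^ p * G (u x))) ≤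
      ∫⁻ x in Ω, ENNReal.ofReal (((a₁ x + b₂ x) * |u x| ^ p +
        b * (2 * b / lam) ^ (p - 1) * |u x| ^ p + a₂ x + b₃ x * |u x|) * G (u x)) := by
  obtain ⟨hbl, hw⟩ := hu
  obtain ⟨i1, i2, heq⟩ := hw _ _ (hbl.comp hp hpN hF hF0 hG hL)
  have hp0 : 0 < p := by linarith
  set T : Space N → ℝ := fun x => ((a₁ x + b₂ x) * |u x| ^ p +
        b * (2 * b / lam) ^ (p - 1) * |u x| ^ p + a₂ x + b₃ x * |u x|) * G (u x) with hT
  have mu : AEMeasurable u (volume.restrict Ω) := hbl.1.1.aemeasurable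
  have mGu : AEStronglyMeasurable (fun x => G (u x)) (volume.restrict Ω) :=
    hG.continuous.comp_aestronglyMeasurable hbl.1.1
  have mup : AEStronglyMeasurable (fun x => |u x| ^ p) (volume.restrict Ω) :=
    (mu.norm.pow_const p).aestronglyMeasurable
  have mT : AEStronglyMeasurable T (volume.restrict Ω) :=
    (((((ma₁.add mb₂).mul mup).add (mup.const_mul _)).add ma₂).add
      (mb₃.mul mu.norm.aestronglyMeasurable)).mul mGu
  have hT0 : 0 ≤ᵐ[volume.restrict Ω] T := by
    filter_upwards [hs.nonneg] with x ⟨h1, h2, _, h4, h5⟩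
    have := hG0 (u x)
    simp only [hT, Pi.zero_apply]
    positivity
  -- If the right-hand side is infinite, there is nothing to prove.
  by_cases hfin : ∫⁻ x in Ω, ENNReal.ofReal (T x) = ⊤
  · rw [hfin]; exact le_top
  have iT : Integrable T (volume.restrict Ω) :=
    (lintegral_ofReal_ne_top_iff_integrable mT hT0).1 hfin
  have iE : Integrable (fun x => lam / 2 * (‖g x‖ ^ p * G (u x))) (volume.restrict Ω) := by
    refine Integrable.const_mul ?_ _
    have hg := hbl.2.1.integrable_norm_rpow (by simpa using hp0) ENNReal.ofReal_ne_top
    rw [ENNReal.toReal_ofReal hp0.le] at hg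
    exact hg.mul_bdd (c := L) mGu (Eventually.of_forall fun x => hL _)
  have hpt : ∀ᵐ x ∂(volume.restrict Ω), lam / 2 * (‖g x‖ ^ p * G (u x)) ≤
      inner ℝ (A x (u x) (g x)) (G (u x) • g x) - B x (u x) (g x) * F (u x) + T x := by
    filter_upwards [hs.nonneg, hs.s1, hs.s2, hb] with x ⟨h1, h2, h3, h4, h5⟩ hA hB hbx
    have hGx := hG0 (u x)
    have e1 := mul_le_mul_of_nonneg_left (hA (u x) (g x)) hGx
    have e2 : B x (u x) (g x) * F (u x) ≤
        (b₁ x * ‖g x‖ ^ (p - 1) + b₂ x * |u x| ^ (p - 1) + b₃ x) * (|u x| * G (u x)) := by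
      refine (le_abs_self _).trans ?_
      rw [abs_mul]
      exact mul_le_mul (hB _ _) (hFG _) (abs_nonneg _) ((abs_nonneg _).trans (hB _ _))
    have e3 : b₁ x * ‖g x‖ ^ (p - 1) * |u x| ≤
        lam / 2 * ‖g x‖ ^ p + b * (2 * b / lam) ^ (p - 1) * |u x| ^ p := by
      refine le_trans ?_ (mul_rpow_sub_one_mul_le hp hlam hb0 (norm_nonneg _) (abs_nonneg _))
      gcongr
    have e4 := mul_le_mul_of_nonneg_right e3 hGx
    have e5 := rpow_sub_one_mul_self hp (abs_nonneg (u x))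
    rw [inner_smul_right]
    simp only [hT]
    rw [← e5] at e1 e4 ⊢
    linarith
  rw [← ofReal_integral_eq_lintegral_ofReal iE, ← ofReal_integral_eq_lintegral_ofReal iT hT0]
  · refine ENNReal.ofReal_le_ofReal ((integral_mono_ae iE ((i1.sub i2).add iT) hpt).trans_eq ?_)
    have e1 := integral_add (i1.sub i2) iT
    have e2 := integral_sub i1 i2
    simp only [Pi.sub_apply, Pi.add_apply] at e1 e2 ⊢
    rw [e1, e2, heq, sub_self, zero_add]
  · exact Eventually.of_forall fun x => by
      have := hG0 (u x)
      simp only [Pi.zero_apply]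
      positivity

end Quasilinear

/-! ### One step of the iteration -/

namespace Quasilinear

section Abstract

variable {X : Type*} [MeasurableSpace X] {μ : Measure X} {p χ : ℝ}

/-- Hölder's inequality for `c W^p`, followed by the interpolation of `W` between `L^p` and
`L^{χ p}`. -/
theorem lintegral_mul_rpow_interpolation {c W : X → ℝ≥0∞} {Q τ : ℝ} (hp : 0 < p) (hχ : 1 < χ)
    (hQ : 0 < Q) (hτ0 : 0 ≤ τ) (hτ1 : τ ≤ 1) (hQτ : 1 / Q = τ * (1 - 1 / χ))
    (hc : AEMeasurable c μ) (hW : AEMeasurable W μ) :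
    ∫⁻ x, c x * W x ^ p ∂μ ≤ (∫⁻ x, c x ^ Q ∂μ) ^ (1 / Q) *
      ((∫⁻ x, W x ^ p ∂μ) ^ (1 - τ) * ((∫⁻ x, W x ^ (χ * p) ∂μ) ^ (1 / χ)) ^ τ) := by
  have hχ0 : 0 < χ := by linarith
  have key := ENNReal.lintegral_prod_norm_pow_le (μ := μ) (Finset.univ : Finset (Fin 3))
    (f := ![fun x => c x ^ Q, fun x => W x ^ p, fun x => W x ^ (χ * p)])
    (p := ![1 / Q, 1 - τ, τ / χ])
    (by
      intro i _
      fin_cases i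
      · exact hc.pow_const _
      · exact hW.pow_const _
      · exact hW.pow_const _)
    (by simp [Fin.sum_univ_three]; rw [← one_div, hQτ]; field_simp; ring)
    (by
      intro i _
      fin_cases i
      · simp; positivity
      · simp; linarith
      · simp; positivity)
  simp only [Fin.prod_univ_three, Matrix.cons_val_zero, Matrix.cons_val_one, Matrix.cons_val] at key
  have e1 : ∀ x, (c x ^ Q) ^ (1 / Q) * (W x ^ p) ^ (1 - τ) * (W x ^ (χ * p)) ^ (τ / χ) =
      c x * W x ^ p := by
    intro x
    rw [← ENNReal.rpow_mul, mul_one_div_cancel hQ.ne', ENNReal.rpow_one, mul_assoc,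
      ← ENNReal.rpow_mul, ← ENNReal.rpow_mul, ← ENNReal.rpow_add_of_nonneg]
    · congr 2; field_simp; ring
    · exact mul_nonneg hp.le (by linarith)
    · positivity
  simp only [e1] at key
  rw [← ENNReal.rpow_mul, ← mul_assoc]
  convert key using 3
  ring

/-- Absorption of a sublinear power of the left-hand side. -/
theorem le_of_le_add_rpow_mul_rpow {D Q c Y Z : ℝ≥0∞} {τ : ℝ} (hτ0 : 0 ≤ τ) (hτ1 : τ < 1)
    (hZ : Z ≠ ⊤) (h : Z ≤ D * (Q + c * (Y ^ (1 - τ) * Z ^ τ))) :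
    Z ≤ (2 * D * c) ^ (1 / (1 - τ)) * Y + 2 * D * Q := by
  have h1τ : 0 < 1 - τ := by linarith
  rcases le_total (c * (Y ^ (1 - τ) * Z ^ τ)) Q with hc | hc
  · calc Z ≤ D * (Q + Q) := h.trans (by gcongr)
      _ = 2 * D * Q := by ring
      _ ≤ _ := le_add_self
  · rcases eq_or_ne Z 0 with rfl | hZ0
    · exact zero_le
    refine le_trans ?_ le_self_add
    have hZτ0 : Z ^ τ ≠ 0 := by simp [hZ0, hZ]
    have hZτ : Z ^ τ ≠ ⊤ := ENNReal.rpow_ne_top_of_nonneg hτ0 hZ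
    have h2 : Z ^ (1 - τ) * Z ^ τ ≤ 2 * D * c * Y ^ (1 - τ) * Z ^ τ := by
      rw [← ENNReal.rpow_add _ _ hZ0 hZ, sub_add_cancel, ENNReal.rpow_one]
      calc Z ≤ D * (c * (Y ^ (1 - τ) * Z ^ τ) + c * (Y ^ (1 - τ) * Z ^ τ)) :=
            h.trans (by gcongr)
        _ = _ := by ring
    rw [ENNReal.mul_le_mul_iff_left hZτ0 hZτ] at h2
    have h3 := ENNReal.rpow_le_rpow h2 (z := 1 / (1 - τ)) (by positivity)
    rwa [ENNReal.mul_rpow_of_nonneg _ _ (by positivity), ← ENNReal.rpow_mul, ← ENNReal.rpow_mul,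
      mul_one_div_cancel h1τ.ne', ENNReal.rpow_one, ENNReal.rpow_one] at h3

/-- Hölder's inequality for the lower-order terms of the energy inequality. -/
theorem lintegral_mul_rpow_le {a v : X → ℝ≥0∞} {r t : ℝ} (ht0 : 0 < t) (htr : t ≤ r)
    (ha : AEMeasurable a μ) (hv : AEMeasurable v μ) :
    ∫⁻ x, a x * v x ^ (r - t) ∂μ ≤
      (∫⁻ x, a x ^ (r / t) ∂μ) ^ (t / r) * (∫⁻ x, v x ^ r ∂μ) ^ ((r - t) / r) := by
  have hr : 0 < r := by linarith
  have key := ENNReal.lintegral_mul_norm_pow_le (μ := μ) (ha.pow_const (r / t)) (hv.pow_const r)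
    (p := t / r) (q := (r - t) / r) (by positivity) (div_nonneg (by linarith) hr.le)
    (by field_simp; ring)
  refine le_trans (lintegral_mono fun x => ?_) key
  rw [← ENNReal.rpow_mul, ← ENNReal.rpow_mul, div_mul_div_comm, mul_comm t r,
    div_self (by positivity), ENNReal.rpow_one, mul_div_cancel₀ _ hr.ne']

/-- The maximum on the right dominates every power between `U ^ (r - p)` and `U ^ r`; these are
the powers of `U = |u|_r` that the data terms produce. -/
theorem rpow_le_max_rpow {U : ℝ≥0∞} {r t : ℝ} (hr : 0 < r) (h1 : r - p ≤ t)
    (h2 : t ≤ r) : U ^ t ≤ max U (U ^ (1 - p / r)) ^ r := by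
  rcases le_total U 1 with hU | hU
  · calc U ^ t ≤ U ^ (r - p) := ENNReal.rpow_le_rpow_of_exponent_ge hU h1
      _ = (U ^ (1 - p / r)) ^ r := by
        rw [← ENNReal.rpow_mul]; congr 1; field_simp
      _ ≤ _ := ENNReal.rpow_le_rpow (le_max_right _ _) hr.le
  · calc U ^ t ≤ U ^ r := ENNReal.rpow_le_rpow_of_exponent_le hU h2
      _ ≤ _ := ENNReal.rpow_le_rpow (le_max_left _ _) hr.le

/-- One step of Moser's iteration for the truncated powers `W = v min(v, k)^{(r-p)/p}`. -/
theorem moser_step_truncated {v w c a b : X → ℝ≥0∞} {r Q τ : ℝ} {D Cb Kc Ka Kb : ℝ≥0∞}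
    (hp : 1 < p) (hχ : 1 < χ) (hpr : p < r)
    (hQ : 0 < Q) (hτ0 : 0 ≤ τ) (hτ1 : τ < 1) (hQτ : 1 / Q = τ * (1 - 1 / χ))
    (hv : AEMeasurable v μ) (hw : AEMeasurable w μ) (hwv : ∀ x, w x ≤ v x)
    (hc : AEMeasurable c μ) (ha : AEMeasurable a μ) (hb : AEMeasurable b μ)
    (hKc : (∫⁻ x, c x ^ Q ∂μ) ^ (1 / Q) ≤ Kc)
    (hKa : (∫⁻ x, a x ^ (r / p) ∂μ) ^ (p / r) ≤ Ka)
    (hKb : (∫⁻ x, b x ^ (r / (p - 1)) ∂μ) ^ ((p - 1) / r) ≤ Kb)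
    (hfin : ∫⁻ x, (v x * w x ^ ((r - p) / p)) ^ (χ * p) ∂μ ≠ ⊤)
    (hen : (∫⁻ x, (v x * w x ^ ((r - p) / p)) ^ (χ * p) ∂μ) ^ (1 / χ) ≤
      D * ∫⁻ x, (c x * (v x * w x ^ ((r - p) / p)) ^ p + Cb * (v x * w x ^ ((r - p) / p)) ^ p +
        a x * w x ^ (r - p) + b x * (v x * w x ^ (r - p))) ∂μ) :
    (∫⁻ x, (v x * w x ^ ((r - p) / p)) ^ (χ * p) ∂μ) ^ (1 / χ) ≤
      ((2 * D * Kc) ^ (1 / (1 - τ)) + 2 * D * (Cb + Ka + Kb)) *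
        max ((∫⁻ x, v x ^ r ∂μ) ^ (1 / r)) (((∫⁻ x, v x ^ r ∂μ) ^ (1 / r)) ^ (1 - p / r)) ^ r := by
  have hp0 : 0 < p := by linarith
  have hr0 : 0 < r := by linarith
  have hs : 0 < r - p := by linarith
  set W : X → ℝ≥0∞ := fun x => v x * w x ^ ((r - p) / p) with hWdef
  have hW : AEMeasurable W μ := hv.mul (hw.pow_const _)
  set U := (∫⁻ x, v x ^ r ∂μ) ^ (1 / r) with hU
  set m := max U (U ^ (1 - p / r)) ^ r with hm
  have hIU : ∀ t : ℝ, (∫⁻ x, v x ^ r ∂μ) ^ (t / r) = U ^ t := fun t => by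
    rw [hU, ← ENNReal.rpow_mul]; congr 1; ring
  have hWv : ∀ x, W x ^ p ≤ v x ^ r := fun x => by
    calc W x ^ p ≤ (v x * v x ^ ((r - p) / p)) ^ p := by
          refine ENNReal.rpow_le_rpow (mul_le_mul_right ?_ _) hp0.le
          exact ENNReal.rpow_le_rpow (hwv x) (by positivity)
      _ = v x ^ r := by
          rw [ENNReal.mul_rpow_of_nonneg _ _ hp0.le, ← ENNReal.rpow_mul,
            ← ENNReal.rpow_add_of_nonneg _ _ hp0.le (by positivity)]
          congr 1; field_simp; ring
  have hY : ∫⁻ x, W x ^ p ∂μ ≤ m := by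
    refine (lintegral_mono hWv).trans ?_
    have := hIU r
    rw [div_self hr0.ne', ENNReal.rpow_one] at this
    rw [this]
    exact rpow_le_max_rpow hr0 (by linarith) le_rfl
  have hA : ∫⁻ x, a x * w x ^ (r - p) ∂μ ≤ Ka * m := by
    refine (lintegral_mono fun x => mul_le_mul_right
      (ENNReal.rpow_le_rpow (hwv x) hs.le) _).trans ?_
    refine (lintegral_mul_rpow_le hp0 hpr.le ha hv).trans ?_
    rw [hIU]
    exact mul_le_mul' hKa (rpow_le_max_rpow hr0 le_rfl (by linarith))
  have hB : ∫⁻ x, b x * (v x * w x ^ (r - p)) ∂μ ≤ Kb * m := by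
    have : ∀ x, b x * (v x * w x ^ (r - p)) ≤ b x * v x ^ (r - (p - 1)) := fun x => by
      refine mul_le_mul_right ?_ _
      calc v x * w x ^ (r - p) ≤ v x * v x ^ (r - p) :=
            mul_le_mul_right (ENNReal.rpow_le_rpow (hwv x) hs.le) _
        _ = v x ^ (r - (p - 1)) := by
            nth_rw 1 [← ENNReal.rpow_one (v x)]
            rw [← ENNReal.rpow_add_of_nonneg _ _ zero_le_one hs.le]; congr 1; ring
    refine (lintegral_mono this).trans ?_
    refine (lintegral_mul_rpow_le (by linarith) (by linarith) hb hv).trans ?_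
    rw [hIU]
    exact mul_le_mul' hKb (rpow_le_max_rpow hr0 (by linarith) (by linarith))
  have hZ : (∫⁻ x, W x ^ (χ * p) ∂μ) ^ (1 / χ) ≠ ⊤ :=
    ENNReal.rpow_ne_top_of_nonneg (by positivity) hfin
  set Z := (∫⁻ x, W x ^ (χ * p) ∂μ) ^ (1 / χ)
  have hmain : Z ≤ D * ((Cb + Ka + Kb) * m + Kc * (m ^ (1 - τ) * Z ^ τ)) := by
    refine hen.trans (mul_le_mul_right ?_ _)
    have m1 : AEMeasurable (fun x => c x * W x ^ p) μ := hc.mul (hW.pow_const _)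
    have m2 : AEMeasurable (fun x => Cb * W x ^ p) μ := (hW.pow_const _).const_mul _
    have m3 : AEMeasurable (fun x => a x * w x ^ (r - p)) μ := ha.mul (hw.pow_const _)
    have m12 : AEMeasurable (fun x => c x * W x ^ p + Cb * W x ^ p) μ := m1.add m2
    have m123 : AEMeasurable (fun x => c x * W x ^ p + Cb * W x ^ p + a x * w x ^ (r - p)) μ :=
      m12.add m3
    rw [lintegral_add_left' m123, lintegral_add_left' m12, lintegral_add_left' m1,
      lintegral_const_mul'' _ (hW.pow_const _)]
    have hcW : ∫⁻ x, c x * W x ^ p ∂μ ≤ Kc * (m ^ (1 - τ) * Z ^ τ) := by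
      refine (lintegral_mul_rpow_interpolation hp0 hχ hQ hτ0 hτ1.le hQτ hc hW).trans ?_
      gcongr
    calc _ ≤ Kc * (m ^ (1 - τ) * Z ^ τ) + Cb * m + Ka * m + Kb * m := by gcongr
      _ = _ := by ring
  refine (le_of_le_add_rpow_mul_rpow hτ0 hτ1 hZ hmain).trans_eq ?_
  ring

/-- One step of Moser's iteration, from `L^r` to `L^{χ r}`, by letting the truncation level `k`
tend to infinity. -/
theorem moser_step {v c a b : X → ℝ≥0∞} {r Q τ : ℝ} {D Cb Kc Ka Kb : ℝ≥0∞}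
    (hp : 1 < p) (hχ : 1 < χ) (hpr : p < r)
    (hQ : 0 < Q) (hτ0 : 0 ≤ τ) (hτ1 : τ < 1) (hQτ : 1 / Q = τ * (1 - 1 / χ))
    (hv : AEMeasurable v μ) (hvtop : ∀ x, v x ≠ ⊤)
    (hc : AEMeasurable c μ) (ha : AEMeasurable a μ) (hb : AEMeasurable b μ)
    (hKc : (∫⁻ x, c x ^ Q ∂μ) ^ (1 / Q) ≤ Kc)
    (hKa : (∫⁻ x, a x ^ (r / p) ∂μ) ^ (p / r) ≤ Ka)
    (hKb : (∫⁻ x, b x ^ (r / (p - 1)) ∂μ) ^ ((p - 1) / r) ≤ Kb)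
    (hfin : ∫⁻ x, v x ^ (χ * p) ∂μ ≠ ⊤)
    (hen : ∀ k : ℕ, (∫⁻ x, (v x * min (v x) k ^ ((r - p) / p)) ^ (χ * p) ∂μ) ^ (1 / χ) ≤
      D * ∫⁻ x, (c x * (v x * min (v x) k ^ ((r - p) / p)) ^ p +
        Cb * (v x * min (v x) k ^ ((r - p) / p)) ^ p +
        a x * min (v x) k ^ (r - p) + b x * (v x * min (v x) k ^ (r - p))) ∂μ) :
    (∫⁻ x, v x ^ (χ * r) ∂μ) ^ (1 / χ) ≤
      ((2 * D * Kc) ^ (1 / (1 - τ)) + 2 * D * (Cb + Ka + Kb)) *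
        max ((∫⁻ x, v x ^ r ∂μ) ^ (1 / r)) (((∫⁻ x, v x ^ r ∂μ) ^ (1 / r)) ^ (1 - p / r)) ^ r := by
  have hp0 : 0 < p := by linarith
  have hs : 0 < r - p := by linarith
  have hσ : 0 < (r - p) / p := by positivity
  have hχ0 : 0 < χ := by linarith
  have hmeas : ∀ k : ℕ, AEMeasurable (fun x => min (v x) (k : ℝ≥0∞)) μ := fun k =>
    hv.min aemeasurable_const
  have hlim : Tendsto (fun k : ℕ => ∫⁻ x, (v x * min (v x) k ^ ((r - p) / p)) ^ (χ * p) ∂μ) atTop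
      (𝓝 (∫⁻ x, v x ^ (χ * r) ∂μ)) := by
    refine lintegral_tendsto_of_tendsto_of_monotone
      (fun k => (hv.mul ((hmeas k).pow_const _)).pow_const _)
      (Eventually.of_forall fun x i j hij => ?_) (Eventually.of_forall fun x => ?_)
    · dsimp only
      gcongr
    · refine tendsto_const_nhds.congr' ?_
      obtain ⟨k₀, hk₀⟩ := ENNReal.exists_nat_gt (hvtop x)
      filter_upwards [eventually_ge_atTop k₀] with k hk
      rw [min_eq_left (hk₀.le.trans (by exact_mod_cast hk))]
      nth_rw 2 [← ENNReal.rpow_one (v x)]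
      rw [← ENNReal.rpow_add_of_nonneg _ _ zero_le_one hσ.le, ← ENNReal.rpow_mul]
      congr 1; field_simp; ring
  refine le_of_tendsto' (((ENNReal.continuous_rpow_const (y := 1 / χ)).tendsto _).comp hlim)
    fun k => ?_
  refine moser_step_truncated hp hχ hpr hQ hτ0 hτ1 hQτ hv (hmeas k) (fun x => min_le_left _ _)
    hc ha hb hKc hKa hKb ?_ (hen k)
  refine ne_top_of_le_ne_top ?_ (lintegral_mono fun x =>
    show _ ≤ (k ^ ((r - p) / p) : ℝ≥0∞) ^ (χ * p) * v x ^ (χ * p) from ?_)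
  · rw [lintegral_const_mul' _ _ (by finiteness)]
    finiteness
  · rw [← ENNReal.mul_rpow_of_nonneg _ _ (by positivity), mul_comm]
    gcongr
    exact min_le_right _ _

end Abstract

end Quasilinear

/-! ### Iteration and passage to the `L^∞` norm -/

namespace Quasilinear

theorem rpow_le_max_rpow_of_le {a : ℝ≥0∞} {t θ : ℝ} (h1 : θ ≤ t) (h2 : t ≤ 1) :
    a ^ t ≤ max a (a ^ θ) := by
  rcases le_total a 1 with ha | ha
  · exact (ENNReal.rpow_le_rpow_of_exponent_ge ha h1).trans (le_max_right _ _)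
  · refine le_trans ?_ (le_max_left _ _)
    simpa using ENNReal.rpow_le_rpow_of_exponent_le ha h2

/-- Bernoulli's inequality, in the form that keeps the exponents of the iteration away from `0`:
each factor `1 - (p / β) χ⁻ⁱ` is at least `(1 - p / β) ^ χ⁻ⁱ`, and these powers have a summable
sequence of exponents. -/
theorem one_sub_rpow_le {x y : ℝ} (hx1 : x ≤ 1) (hy0 : 0 ≤ y) (hy1 : y ≤ 1) :
    (1 - x) ^ y ≤ 1 - x * y := by
  have := _root_.rpow_one_add_le_one_add_mul_self (s := -x) (by linarith) hy0 hy1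
  rw [← sub_eq_add_neg] at this
  linarith

/-- The iterated one-step inequality. The exponents `1 - p / (β χ ^ j)` of the steps multiply up to
an exponent that is bounded below by a power of `1 - p / β`. -/
theorem moser_recursion {a : ℕ → ℝ≥0∞} {B : ℝ≥0∞} {p β χ : ℝ} (hp : 0 < p) (hβ : p < β)
    (hχ : 1 < χ) (hB : 1 ≤ B)
    (ha : ∀ j, a (j + 1) ≤ B ^ ((1 + j : ℝ) / (β * χ ^ j)) *
      max (a j) (a j ^ (1 - p / (β * χ ^ j)))) (j : ℕ) :
    a j ≤ B ^ (∑ i ∈ Finset.range j, (1 + i : ℝ) / (β * χ ^ i)) *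
      max (a 0) (a 0 ^ ((1 - p / β) ^ (∑ i ∈ Finset.range j, (χ ^ i)⁻¹))) := by
  have hβ0 : 0 < β := hp.trans hβ
  have hχ0 : 0 < χ := by linarith
  have hd0 : 0 < 1 - p / β := by rw [sub_pos, div_lt_one hβ0]; exact hβ
  have hd1 : 1 - p / β ≤ 1 := by have : 0 < p / β := by positivity
                                 linarith
  induction j with
  | zero => simp
  | succ j ih =>
    refine (ha j).trans ?_
    rw [Finset.sum_range_succ, Finset.sum_range_succ, Real.rpow_add hd0,
      add_comm (∑ i ∈ Finset.range j, (1 + i : ℝ) / (β * χ ^ i)),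
      ENNReal.rpow_add_of_nonneg _ _ (by positivity) (by positivity), mul_assoc]
    refine mul_le_mul_right ?_ _
    set θ := (1 - p / β) ^ (∑ i ∈ Finset.range j, (χ ^ i)⁻¹) with hθ
    set BE := B ^ (∑ i ∈ Finset.range j, (1 + i : ℝ) / (β * χ ^ i)) with hBE
    set δ' := (1 - p / β) ^ (χ ^ j)⁻¹ with hδ'
    have hχj : 1 ≤ χ ^ j := one_le_pow₀ hχ.le
    have hδ : δ' ≤ 1 - p / (β * χ ^ j) := by
      have := one_sub_rpow_le (x := p / β) (y := (χ ^ j)⁻¹) (by linarith)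
        (by positivity) (inv_le_one_of_one_le₀ hχj)
      rwa [← div_eq_mul_inv, div_div] at this
    have hδ1 : 1 - p / (β * χ ^ j) ≤ 1 := by
      have : 0 < p / (β * χ ^ j) := by positivity
      linarith
    have hδ'0 : 0 < δ' := Real.rpow_pos_of_pos hd0 _
    have hθ0 : 0 < θ := Real.rpow_pos_of_pos hd0 _
    have hθ1 : θ ≤ 1 := Real.rpow_le_one hd0.le hd1 (by positivity)
    have hBE1 : 1 ≤ BE := by
      simpa using ENNReal.rpow_le_rpow hB
        (z := ∑ i ∈ Finset.range j, (1 + i : ℝ) / (β * χ ^ i)) (by positivity)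
    set δ := 1 - p / (β * χ ^ j)
    have hδ0 : 0 < δ := hδ'0.trans_le hδ
    have hm : ∀ t : ℝ, δ' ≤ t → t ≤ 1 → (max (a 0) (a 0 ^ θ)) ^ t ≤
        max (a 0) (a 0 ^ (θ * δ')) := by
      intro t ht0 ht1
      rw [(ENNReal.monotone_rpow_of_nonneg (hδ'0.le.trans ht0)).map_max, ← ENNReal.rpow_mul]
      refine max_le (rpow_le_max_rpow_of_le ?_ ht1) (rpow_le_max_rpow_of_le ?_ ?_)
      · exact (mul_le_of_le_one_left hδ'0.le hθ1).trans ht0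
      · exact mul_le_mul_of_nonneg_left ht0 hθ0.le
      · exact mul_le_one₀ hθ1 (hδ'0.le.trans ht0) ht1
    refine max_le (ih.trans (mul_le_mul_right ?_ _)) ?_
    · simpa using hm 1 (hδ.trans hδ1) le_rfl
    · refine (ENNReal.rpow_le_rpow ih hδ0.le).trans ?_
      rw [ENNReal.mul_rpow_of_nonneg _ _ hδ0.le]
      refine mul_le_mul' ?_ (hm _ hδ hδ1)
      simpa using ENNReal.rpow_le_rpow_of_exponent_le hBE1 hδ1

/-- The limiting form of `moser_recursion`. -/
theorem moser_recursion_bound {a : ℕ → ℝ≥0∞} {B : ℝ≥0∞} {p β χ : ℝ} (hp : 0 < p) (hβ : p < β)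
    (hχ : 1 < χ) (hB : 1 ≤ B)
    (ha : ∀ j, a (j + 1) ≤ B ^ ((1 + j : ℝ) / (β * χ ^ j)) *
      max (a j) (a j ^ (1 - p / (β * χ ^ j)))) (j : ℕ) :
    a j ≤ B ^ (∑' i : ℕ, (1 + i : ℝ) / (β * χ ^ i)) *
      max (a 0) (a 0 ^ ((1 - p / β) ^ (1 - χ⁻¹)⁻¹)) := by
  have hβ0 : 0 < β := hp.trans hβ
  have hχ0 : 0 < χ := by linarith
  have hd0 : 0 < 1 - p / β := by rw [sub_pos, div_lt_one hβ0]; exact hβ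
  have hd1 : 1 - p / β ≤ 1 := by have : 0 < p / β := by positivity
                                 linarith
  have hχi : χ⁻¹ < 1 := inv_lt_one_of_one_lt₀ hχ
  have hg : HasSum (fun i : ℕ => (χ ^ i)⁻¹) (1 - χ⁻¹)⁻¹ := by
    simpa using hasSum_geometric_of_lt_one (by positivity) hχi
  have hs : Summable (fun i : ℕ => (1 + i : ℝ) / (β * χ ^ i)) := by
    have h1 : Summable fun i : ℕ => ((i : ℝ) ^ 1 * χ⁻¹ ^ i) :=
      summable_pow_mul_geometric_of_norm_lt_one 1
        (by rwa [Real.norm_eq_abs, abs_of_nonneg (by positivity)])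
    refine ((hg.summable.add h1).mul_left β⁻¹).congr fun i => ?_
    rw [inv_pow]; field_simp
  refine (moser_recursion hp hβ hχ hB ha j).trans (mul_le_mul' ?_ (max_le (le_max_left _ _) ?_))
  · exact ENNReal.rpow_le_rpow_of_exponent_le hB
      (hs.sum_le_tsum _ fun i _ => by positivity)
  · refine rpow_le_max_rpow_of_le ?_ (Real.rpow_le_one hd0.le hd1 (by positivity))
    exact Real.rpow_le_rpow_of_exponent_ge hd0 hd1 (sum_le_hasSum _ (fun i _ => by positivity) hg)

section Abstract

variable {X E : Type*} [MeasurableSpace X] {μ : Measure X} [NormedAddCommGroup E]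

/-- A bound on the `L^r` norms along a sequence of exponents `r → ∞` bounds the `L^∞` norm. -/
theorem eLpNorm_top_le_of_forall_eLpNorm_le {f : X → E} (hf : AEStronglyMeasurable f μ)
    {r : ℕ → ℝ} (hr : Tendsto r atTop atTop) {K : ℝ≥0∞}
    (h : ∀ j, eLpNorm f (ENNReal.ofReal (r j)) μ ≤ K) : eLpNorm f ⊤ μ ≤ K := by
  refine le_of_forall_gt_imp_ge_of_dense fun ε hε => ?_
  rcases eq_or_ne ε ⊤ with rfl | hεt
  · exact le_top
  have hε0 : ε ≠ 0 := (zero_le.trans_lt hε).ne'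
  have hq : K / ε < 1 := ENNReal.div_lt_of_lt_mul (by simpa using hε)
  have hlim : Tendsto (fun j => (K / ε) ^ (r j)) atTop (𝓝 0) :=
    (ENNReal.tendsto_rpow_atTop_of_base_lt_one hq).comp hr
  have hb : ∀ᶠ j in atTop, μ {x | ε ≤ ‖f x‖ₑ} ≤ (K / ε) ^ (r j) := by
    filter_upwards [hr.eventually_gt_atTop 0] with j hj
    have h1 := mul_meas_ge_le_pow_eLpNorm' μ (p := ENNReal.ofReal (r j)) (by simpa using hj)
      ENNReal.ofReal_ne_top hf ε
    rw [ENNReal.toReal_ofReal hj.le] at h1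
    rw [ENNReal.div_rpow_of_nonneg _ _ hj.le, ENNReal.le_div_iff_mul_le (Or.inl (by simp [hε0, hεt]))
      (Or.inl (by finiteness)), mul_comm]
    exact h1.trans (ENNReal.rpow_le_rpow (h j) hj.le)
  have h0 : μ {x | ε ≤ ‖f x‖ₑ} = 0 := le_antisymm (ge_of_tendsto hlim hb) zero_le
  rw [eLpNorm_exponent_top]
  refine eLpNormEssSup_le_of_ae_enorm_bound ?_
  have : ∀ᵐ x ∂μ, ¬ ε ≤ ‖f x‖ₑ := by rw [ae_iff]; simpa using h0
  exact this.mono fun x hx => (not_le.1 hx).le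

/-- The `L^r` norm is controlled by the norm of `L^{r₀} ∩ L^∞` for `r₀ ≤ r`. -/
theorem lintegral_rpow_le_eLpNorm_add_eLpNorm_top {f : X → E} {r₀ r : ℝ} (h0 : 0 < r₀)
    (hr : r₀ ≤ r) :
    (∫⁻ x, ‖f x‖ₑ ^ r ∂μ) ^ (1 / r) ≤
      eLpNorm f (ENNReal.ofReal r₀) μ + eLpNorm f ⊤ μ := by
  have hr0 : 0 < r := h0.trans_le hr
  set n := eLpNorm f (ENNReal.ofReal r₀) μ with hn
  set M := eLpNorm f ⊤ μ with hM
  have hn' : ∫⁻ x, ‖f x‖ₑ ^ r₀ ∂μ = n ^ r₀ := by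
    rw [hn, eLpNorm_eq_lintegral_rpow_enorm_toReal (by simpa using h0) ENNReal.ofReal_ne_top,
      ENNReal.toReal_ofReal h0.le, ← ENNReal.rpow_mul, one_div_mul_cancel h0.ne',
      ENNReal.rpow_one]
  rcases eq_or_ne (n + M) ⊤ with ht | ht
  · rw [ht]; exact le_top
  have hMt : M ≠ ⊤ := ne_top_of_le_ne_top ht le_add_self
  rw [one_div, ENNReal.rpow_inv_le_iff hr0]
  calc ∫⁻ x, ‖f x‖ₑ ^ r ∂μ ≤ ∫⁻ x, M ^ (r - r₀) * ‖f x‖ₑ ^ r₀ ∂μ := by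
        refine lintegral_mono_ae ?_
        filter_upwards [ae_le_eLpNormEssSup (f := f) (μ := μ)] with x hx
        rw [← eLpNorm_exponent_top] at hx
        calc ‖f x‖ₑ ^ r = ‖f x‖ₑ ^ (r - r₀) * ‖f x‖ₑ ^ r₀ := by
              rw [← ENNReal.rpow_add_of_nonneg _ _ (by linarith) h0.le, sub_add_cancel]
          _ ≤ _ := by
              gcongr
    _ = M ^ (r - r₀) * n ^ r₀ := by
        rw [lintegral_const_mul' _ _ (ENNReal.rpow_ne_top_of_nonneg (by linarith) hMt), hn']
    _ ≤ (n + M) ^ (r - r₀) * (n + M) ^ r₀ := by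
        gcongr
        · exact le_add_self
        · exact le_self_add
    _ = (n + M) ^ r := by
        rw [← ENNReal.rpow_add_of_nonneg _ _ (by linarith) h0.le, sub_add_cancel]

end Abstract

end Quasilinear

/-! ### Truncated powers of a weak solution -/

namespace Quasilinear

/-- The truncated power `min(|t|, k) ^ s`. -/
noncomputable def truncPow (k s t : ℝ) : ℝ := min |t| k ^ s

/-- The primitive `∫₀ᵗ min(|τ|, k) ^ s dτ` of the truncated power. -/
noncomputable def truncPrim (k s t : ℝ) : ℝ := ∫ τ in (0 : ℝ)..t, truncPow k s τ

variable {k s : ℝ}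

theorem truncPow_nonneg (hk : 0 ≤ k) (t : ℝ) : 0 ≤ truncPow k s t :=
  Real.rpow_nonneg (le_min (abs_nonneg t) hk) s

theorem abs_truncPow_le (hk : 0 ≤ k) (hs : 0 ≤ s) (t : ℝ) : |truncPow k s t| ≤ k ^ s := by
  rw [abs_of_nonneg (truncPow_nonneg hk t)]
  exact Real.rpow_le_rpow (le_min (abs_nonneg t) hk) (min_le_right _ _) hs

theorem continuous_truncPow (hs : 0 ≤ s) : Continuous (truncPow k s) :=
  (continuous_abs.min continuous_const).rpow_const fun _ => Or.inr hs

theorem uniformContinuous_truncPow (hs : 0 ≤ s) : UniformContinuous (truncPow k s) := by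
  refine (continuous_truncPow hs).uniformContinuous_of_tendsto_cocompact (x := k ^ s) ?_
  refine tendsto_const_nhds.congr' ?_
  filter_upwards [(tendsto_norm_cocompact_atTop (E := ℝ)).eventually_ge_atTop k] with t ht
  rw [Real.norm_eq_abs] at ht
  rw [truncPow, min_eq_right ht]

theorem hasDerivAt_truncPrim (hs : 0 ≤ s) (t : ℝ) :
    HasDerivAt (truncPrim k s) (truncPow k s t) t :=
  intervalIntegral.integral_hasDerivAt_right ((continuous_truncPow hs).intervalIntegrable _ _)
    ((continuous_truncPow hs).stronglyMeasurableAtFilter _ _) (continuous_truncPow hs).continuousAt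

theorem truncPrim_zero : truncPrim k s 0 = 0 := intervalIntegral.integral_same

theorem truncPow_neg (t : ℝ) : truncPow k s (-t) = truncPow k s t := by
  simp [truncPow]

theorem truncPow_abs (t : ℝ) : truncPow k s |t| = truncPow k s t := by
  simp [truncPow]

theorem truncPrim_neg (t : ℝ) : truncPrim k s (-t) = -truncPrim k s t := by
  have h := intervalIntegral.integral_comp_neg (a := 0) (b := t) (truncPow k s)
  simp only [truncPow_neg, neg_zero] at h
  rw [truncPrim, truncPrim, h, intervalIntegral.integral_symm]

theorem truncPrim_nonneg (hk : 0 ≤ k) {t : ℝ} (ht : 0 ≤ t) : 0 ≤ truncPrim k s t :=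
  intervalIntegral.integral_nonneg ht fun _ _ => truncPow_nonneg hk _

theorem abs_truncPrim (hk : 0 ≤ k) (t : ℝ) : |truncPrim k s t| = truncPrim k s |t| := by
  rcases le_total 0 t with ht | ht
  · rw [abs_of_nonneg ht, abs_of_nonneg (truncPrim_nonneg hk ht)]
  · rw [abs_of_nonpos ht, ← abs_neg, ← truncPrim_neg,
      abs_of_nonneg (truncPrim_nonneg hk (neg_nonneg.2 ht))]

theorem abs_truncPrim_le (hk : 0 ≤ k) (hs : 0 ≤ s) (t : ℝ) :
    |truncPrim k s t| ≤ |t| * truncPow k s t := by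
  rw [abs_truncPrim hk, ← truncPow_abs t]
  have := intervalIntegral.integral_mono_on (abs_nonneg t)
    ((continuous_truncPow (k := k) hs).intervalIntegrable _ _)
    (intervalIntegrable_const (μ := volume) (c := truncPow k s |t|)) fun τ hτ => by
      refine Real.rpow_le_rpow (le_min (abs_nonneg _) hk) (min_le_min_right _ ?_) hs
      rw [abs_of_nonneg hτ.1, abs_abs]
      exact hτ.2
  rwa [intervalIntegral.integral_const, sub_zero, smul_eq_mul] at this

/-- The reverse comparison of a truncated power with its primitive; it follows from
`min(τ, k) ≥ (τ / t) min(t, k)` for `0 ≤ τ ≤ t`. -/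
theorem abs_mul_truncPow_le (hk : 0 ≤ k) (hs : 0 ≤ s) (t : ℝ) :
    |t| * truncPow k s t ≤ (s + 1) * |truncPrim k s t| := by
  rw [abs_truncPrim hk, ← truncPow_abs t]
  rcases (abs_nonneg t).eq_or_lt with h | h
  · rw [← h]; simp [truncPrim_zero]
  set T := |t|
  have := intervalIntegral.integral_mono_on (μ := volume) (a := 0) (b := T) h.le
    (f := fun τ => τ ^ s * (T⁻¹ ^ s * truncPow k s T))
    ((intervalIntegral.intervalIntegrable_rpow (Or.inl hs)).mul_const _)
    ((continuous_truncPow (k := k) hs).intervalIntegrable _ _) fun τ hτ => by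
      have h1 : 0 ≤ min |T| k := le_min (abs_nonneg _) hk
      have h2 : 0 ≤ T⁻¹ := by positivity
      rw [truncPow, truncPow, ← Real.mul_rpow h2 h1, ← Real.mul_rpow hτ.1 (by positivity)]
      refine Real.rpow_le_rpow (mul_nonneg hτ.1 (by positivity)) (le_min ?_ ?_) hs
      · rw [abs_of_pos h, abs_of_nonneg hτ.1]
        calc τ * (T⁻¹ * min T k) ≤ τ * (T⁻¹ * T) := by
              gcongr
              · exact hτ.1
              · exact min_le_left _ _
          _ = τ := by rw [inv_mul_cancel₀ h.ne', mul_one]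
      · calc τ * (T⁻¹ * min |T| k) ≤ T * (T⁻¹ * k) := by
              gcongr
              · exact hτ.2
              · exact min_le_right _ _
          _ = k := by rw [← mul_assoc, mul_inv_cancel₀ h.ne', one_mul]
  rw [intervalIntegral.integral_mul_const, integral_rpow (Or.inl (by linarith)),
    Real.zero_rpow (by linarith), sub_zero] at this
  change _ ≤ truncPrim k s T at this
  refine le_trans (le_of_eq ?_) (mul_le_mul_of_nonneg_left this (by linarith))
  rw [Real.inv_rpow h.le, Real.rpow_add_one h.ne']
  field_simp

variable {N : ℕ} {Ω : Set (Space N)} {p : ℝ} {u : Space N → ℝ} {g : Space N → Space N}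

theorem ofReal_truncPow (k : ℕ) (hs : 0 ≤ s) (t : ℝ) :
    ENNReal.ofReal (truncPow k s t) = min ‖t‖ₑ k ^ s := by
  rw [truncPow, ← ENNReal.ofReal_rpow_of_nonneg (le_min (abs_nonneg t) k.cast_nonneg) hs,
    ENNReal.ofReal_min, Real.enorm_eq_ofReal_abs, ENNReal.ofReal_natCast]

theorem enorm_truncPow (k : ℕ) (hs : 0 ≤ s) (t : ℝ) :
    ‖truncPow k s t‖ₑ = min ‖t‖ₑ k ^ s := by
  rw [Real.enorm_of_nonneg (truncPow_nonneg k.cast_nonneg t), ofReal_truncPow k hs]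

/-- The energy inequality for a truncated power of the solution, combined with the Sobolev
inequality for `truncPrim k ((r - p) / p) u`, whose gradient is `min(|u|, k)^{(r-p)/p} ∇u`. -/
theorem lintegral_truncated_le {lam : ℝ} {A : Space N → ℝ → Space N → Space N}
    {B : Space N → ℝ → Space N → ℝ} {a₁ a₂ b₁ b₂ b₃ : Space N → ℝ} {S : ℝ≥0}
    (hp : 1 < p) (hpN : p < N) (hlam : 0 < lam)
    (hS : ∀ (Ω : Set (Space N)) (u : Space N → ℝ) (g : Space N → Space N),
      IsBeppoLevi Ω p u g →
      eLpNorm u (ENNReal.ofReal (criticalExponent N p)) (volume.restrict Ω) ≤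
        S * eLpNorm g (ENNReal.ofReal p) (volume.restrict Ω))
    (hs : StructureConditions Ω p lam A B a₁ a₂ b₁ b₂ b₃)
    (ma₁ : AEStronglyMeasurable a₁ (volume.restrict Ω))
    (ma₂ : AEStronglyMeasurable a₂ (volume.restrict Ω))
    (mb₂ : AEStronglyMeasurable b₂ (volume.restrict Ω))
    (mb₃ : AEStronglyMeasurable b₃ (volume.restrict Ω))
    {b : ℝ} (hb0 : 0 ≤ b) (hb : ∀ᵐ x ∂(volume.restrict Ω), b₁ x ≤ b)
    (hu : IsWeakSolution Ω p A B u g) {r : ℝ} (hr : p < r) (k : ℕ) :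
    (∫⁻ x in Ω, (‖u x‖ₑ * min ‖u x‖ₑ k ^ ((r - p) / p)) ^ ((N : ℝ) / (N - p) * p)) ^
        (1 / ((N : ℝ) / (N - p))) ≤
      ((ENNReal.ofReal r * S) ^ p * ENNReal.ofReal (2 / lam)) *
      ∫⁻ x in Ω, (‖a₁ x + b₂ x‖ₑ * (‖u x‖ₑ * min ‖u x‖ₑ k ^ ((r - p) / p)) ^ p +
        ENNReal.ofReal (b * (2 * b / lam) ^ (p - 1)) *
          (‖u x‖ₑ * min ‖u x‖ₑ k ^ ((r - p) / p)) ^ p +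
        ‖a₂ x‖ₑ * min ‖u x‖ₑ k ^ (r - p) + ‖b₃ x‖ₑ * (‖u x‖ₑ * min ‖u x‖ₑ k ^ (r - p))) := by
  have hp0 : 0 < p := by linarith
  have hNp : 0 < (N : ℝ) - p := by linarith
  have hN : 0 < (N : ℝ) := by linarith
  have hσ : 0 ≤ (r - p) / p := div_nonneg (by linarith) hp0.le
  have hs0 : 0 ≤ r - p := by linarith
  have hk : (0 : ℝ) ≤ k := k.cast_nonneg
  have hcrit := one_lt_criticalExponent hp hpN
  have hcrit' : (N : ℝ) / (N - p) * p = criticalExponent N p := by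
    rw [criticalExponent, div_mul_eq_mul_div]
  have hpow : ∀ z : ℝ≥0∞, (z ^ ((r - p) / p)) ^ p = z ^ (r - p) := fun z => by
    rw [← ENNReal.rpow_mul, div_mul_cancel₀ _ hp0.ne']
  have hbl := hu.1.comp hp hpN (hasDerivAt_truncPrim (k := k) hσ) truncPrim_zero
    (uniformContinuous_truncPow hσ) (abs_truncPow_le hk hσ)
  have e1 : (∫⁻ x in Ω, (‖u x‖ₑ * min ‖u x‖ₑ k ^ ((r - p) / p)) ^ ((N : ℝ) / (N - p) * p)) ^
        (1 / ((N : ℝ) / (N - p))) = eLpNorm (fun x => u x * truncPow k ((r - p) / p) (u x))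
          (ENNReal.ofReal (criticalExponent N p)) (volume.restrict Ω) ^ p := by
    rw [eLpNorm_eq_lintegral_rpow_enorm_toReal (by simp; linarith) ENNReal.ofReal_ne_top,
      ENNReal.toReal_ofReal (by linarith), ← ENNReal.rpow_mul, hcrit']
    congr 1
    · refine lintegral_congr fun x => ?_
      rw [enorm_mul, enorm_truncPow k hσ]
    · rw [criticalExponent]; field_simp
  have e2 : eLpNorm (fun x => u x * truncPow k ((r - p) / p) (u x))
      (ENNReal.ofReal (criticalExponent N p)) (volume.restrict Ω) ≤ ENNReal.ofReal r *
      eLpNorm (fun x => truncPrim k ((r - p) / p) (u x))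
        (ENNReal.ofReal (criticalExponent N p)) (volume.restrict Ω) := by
    refine eLpNorm_le_mul_eLpNorm_of_ae_le_mul (Eventually.of_forall fun x => ?_) _
    rw [norm_mul, Real.norm_eq_abs, Real.norm_eq_abs, abs_of_nonneg (truncPow_nonneg hk _)]
    refine (abs_mul_truncPow_le hk hσ _).trans (mul_le_mul_of_nonneg_right ?_ (abs_nonneg _))
    rw [sub_div, div_self hp0.ne', sub_add_cancel]
    exact div_le_self (by linarith) hp.le
  have e3 : eLpNorm (fun x => truncPow k ((r - p) / p) (u x) • g x) (ENNReal.ofReal p)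
      (volume.restrict Ω) ^ p = ENNReal.ofReal (2 / lam) *
      ∫⁻ x in Ω, ENNReal.ofReal (lam / 2 * (‖g x‖ ^ p * truncPow k (r - p) (u x))) := by
    rw [eLpNorm_eq_lintegral_rpow_enorm_toReal (by simpa using hp0) ENNReal.ofReal_ne_top,
      ENNReal.toReal_ofReal hp0.le, ← ENNReal.rpow_mul, one_div_mul_cancel hp0.ne',
      ENNReal.rpow_one, ← lintegral_const_mul' _ _ ENNReal.ofReal_ne_top]
    refine lintegral_congr fun x => ?_
    rw [← ENNReal.ofReal_mul (by positivity), ← mul_assoc, div_mul_div_comm, mul_comm 2 lam,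
      div_self (by positivity), one_mul, ENNReal.ofReal_mul (by positivity),
      ofReal_truncPow k hs0, enorm_smul, ENNReal.mul_rpow_of_nonneg _ _ hp0.le,
      enorm_truncPow k hσ, hpow, mul_comm, ← ENNReal.ofReal_rpow_of_nonneg (norm_nonneg _) hp0.le,
      ofReal_norm]
  have e4 := lintegral_energy_le hp hpN hlam hs ma₁ ma₂ mb₂ mb₃ hb0 hb hu
    (hasDerivAt_truncPrim (k := k) hs0) truncPrim_zero (uniformContinuous_truncPow hs0)
    (abs_truncPow_le hk hs0) (truncPow_nonneg hk) (abs_truncPrim_le hk hs0)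
  rw [e1]
  calc _ ≤ (ENNReal.ofReal r * (S * eLpNorm (fun x => truncPow k ((r - p) / p) (u x) • g x)
        (ENNReal.ofReal p) (volume.restrict Ω))) ^ p :=
        ENNReal.rpow_le_rpow (e2.trans (mul_le_mul_right (hS _ _ _ hbl) _)) hp0.le
    _ = (ENNReal.ofReal r * S) ^ p * ENNReal.ofReal (2 / lam) *
        ∫⁻ x in Ω, ENNReal.ofReal (lam / 2 * (‖g x‖ ^ p * truncPow k (r - p) (u x))) := by
      rw [← mul_assoc, ENNReal.mul_rpow_of_nonneg _ _ hp0.le, e3, ← mul_assoc]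
    _ ≤ _ := by
      refine mul_le_mul_right (e4.trans (lintegral_mono fun x => ?_)) _
      have hG := truncPow_nonneg (s := r - p) hk (u x)
      have hup : ENNReal.ofReal (|u x| ^ p * truncPow k (r - p) (u x)) =
          (‖u x‖ₑ * min ‖u x‖ₑ k ^ ((r - p) / p)) ^ p := by
        rw [ENNReal.mul_rpow_of_nonneg _ _ hp0.le, hpow, ENNReal.ofReal_mul (by positivity),
          ofReal_truncPow k hs0, ← ENNReal.ofReal_rpow_of_nonneg (abs_nonneg _) hp0.le,
          Real.enorm_eq_ofReal_abs]
      have hmul : ∀ y z : ℝ, 0 ≤ z → ENNReal.ofReal (y * z) ≤ ‖y‖ₑ * ENNReal.ofReal z :=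
        fun y z hz => by
          rw [ENNReal.ofReal_mul' hz]
          exact mul_le_mul_left (Real.ofReal_le_enorm y) _
      have hb' : 0 ≤ b * (2 * b / lam) ^ (p - 1) := by positivity
      rw [← hup, ← ofReal_truncPow k hs0,
        Real.enorm_eq_ofReal_abs (u x), ← ENNReal.ofReal_mul (abs_nonneg _),
        ← ENNReal.ofReal_mul hb']
      rw [show ∀ c₁ c₂ c₃ c₄ U V G : ℝ, (c₁ * U + c₂ * U + c₃ + c₄ * V) * G =
        c₁ * (U * G) + c₂ * (U * G) + c₃ * G + c₄ * (V * G) by intros; ring]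
      refine ENNReal.ofReal_add_le.trans (add_le_add (ENNReal.ofReal_add_le.trans
        (add_le_add (ENNReal.ofReal_add_le.trans (add_le_add ?_ le_rfl)) ?_)) ?_)
      · exact hmul _ _ (by positivity)
      · exact hmul _ _ hG
      · exact hmul _ _ (by positivity)

end Quasilinear

/-! ### The bound for weak solutions -/

namespace Quasilinear

/-- The constant of one iteration step, up to the factor `r ^ κ`, as a function of the five norms
`d` of the data; `S` is the Sobolev constant and `τ = N / q`. -/
noncomputable def stepConst (p lam τ : ℝ) (S : ℝ≥0) (d : Fin 5 → ℝ≥0) : ℝ≥0 :=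
  1 + ((2 * (S ^ p * (2 / lam).toNNReal) * (d 1 + d 2)) ^ (1 / (1 - τ)) +
    2 * (S ^ p * (2 / lam).toNNReal) * (d 0 * (d 0 * (2 / lam).toNNReal) ^ (p - 1) + d 3 + d 4))

theorem one_le_stepConst (p lam τ : ℝ) (S : ℝ≥0) (d : Fin 5 → ℝ≥0) :
    1 ≤ stepConst p lam τ S d := le_self_add

theorem monotone_stepConst {p lam τ : ℝ} (S : ℝ≥0) (hp : 1 < p) (hτ : τ < 1) :
    Monotone (stepConst p lam τ S) := by
  intro d d' h
  have h0 := h 0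
  have h1 := h 1
  have h2 := h 2
  have h3 := h 3
  have h4 := h 4
  have hp' : 0 ≤ p - 1 := by linarith
  have hτ' : 0 ≤ 1 / (1 - τ) := one_div_nonneg.2 (by linarith)
  unfold stepConst
  gcongr

variable {N : ℕ} {Ω : Set (Space N)} {p : ℝ} {u : Space N → ℝ} {g : Space N → Space N}

theorem eLpNorm_ofReal_eq {X E : Type*} [MeasurableSpace X] {μ : Measure X} [NormedAddCommGroup E]
    (f : X → E) {r : ℝ} (hr : 0 < r) :
    eLpNorm f (ENNReal.ofReal r) μ = (∫⁻ x, ‖f x‖ₑ ^ r ∂μ) ^ (1 / r) := by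
  rw [eLpNorm_eq_lintegral_rpow_enorm_toReal (by simpa using hr) ENNReal.ofReal_ne_top,
    ENNReal.toReal_ofReal hr.le]

/-- The gain of integrability of a weak solution from `L^r` to `L^{χ r}`, `χ = N / (N - p)`. -/
theorem eLpNorm_le_stepConst_mul {q β lam : ℝ} {A : Space N → ℝ → Space N → Space N}
    {B : Space N → ℝ → Space N → ℝ} {a₁ a₂ b₁ b₂ b₃ : Space N → ℝ} {S : ℝ≥0}
    (hp : 1 < p) (hpN : p < N) (hβ : p < β) (hq : N < q) (hlam : 0 < lam)
    (hS : ∀ (Ω : Set (Space N)) (u : Space N → ℝ) (g : Space N → Space N),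
      IsBeppoLevi Ω p u g →
      eLpNorm u (ENNReal.ofReal (criticalExponent N p)) (volume.restrict Ω) ≤
        S * eLpNorm g (ENNReal.ofReal p) (volume.restrict Ω))
    (hs : StructureConditions Ω p lam A B a₁ a₂ b₁ b₂ b₃)
    (ma₁ : AEStronglyMeasurable a₁ (volume.restrict Ω))
    (ma₂ : AEStronglyMeasurable a₂ (volume.restrict Ω))
    (mb₂ : AEStronglyMeasurable b₂ (volume.restrict Ω))
    (mb₃ : AEStronglyMeasurable b₃ (volume.restrict Ω))
    {d : Fin 5 → ℝ≥0} (hb₁ : normOn Ω ⊤ b₁ ≤ d 0)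
    (ha₁ : normOn Ω (ENNReal.ofReal (q / p)) a₁ ≤ d 1)
    (hb₂ : normOn Ω (ENNReal.ofReal (q / p)) b₂ ≤ d 2)
    (ha₂ : interNormOn Ω (ENNReal.ofReal (β / p)) a₂ ≤ d 3)
    (hb₃ : interNormOn Ω (ENNReal.ofReal (β / (p - 1))) b₃ ≤ d 4)
    (hu : IsWeakSolution Ω p A B u g) {r : ℝ} (hr : β ≤ r) :
    normOn Ω (ENNReal.ofReal ((N : ℝ) / (N - p) * r)) u ≤
      (stepConst p lam (N / q) S d * ENNReal.ofReal r ^ (p / (1 - N / q))) ^ (1 / r) *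
        max (normOn Ω (ENNReal.ofReal r) u)
          (normOn Ω (ENNReal.ofReal r) u ^ (1 - p / r)) := by
  have hp0 : 0 < p := by linarith
  have hp1 : 0 < p - 1 := by linarith
  have hr0 : 0 < r := by linarith
  have hNp : 0 < (N : ℝ) - p := by linarith
  have hN : 0 < (N : ℝ) := by linarith
  have hq0 : 0 < q := by linarith
  set χ := (N : ℝ) / (N - p) with hχdef
  have hχ : 1 < χ := by rw [hχdef, one_lt_div hNp]; linarith
  have hχ0 : 0 < χ := by linarith
  set τ := (N : ℝ) / q with hτdef
  have hτ0 : 0 ≤ τ := by positivity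
  have hτ1 : τ < 1 := by rw [hτdef, div_lt_one hq0]; exact hq
  have hτ1' : 0 < 1 - τ := by linarith
  have hcrit : χ * p = criticalExponent N p := by
    rw [hχdef, criticalExponent, div_mul_eq_mul_div]
  have hb : ∀ᵐ x ∂(volume.restrict Ω), b₁ x ≤ (d 0 : ℝ) := by
    filter_upwards [ae_le_eLpNormEssSup (f := b₁) (μ := volume.restrict Ω)] with x hx
    rw [← eLpNorm_exponent_top] at hx
    have h1 := (Real.ofReal_le_enorm _).trans (hx.trans hb₁)
    rwa [← ENNReal.ofReal_coe_nnreal, ENNReal.ofReal_le_ofReal_iff (d 0).coe_nonneg] at h1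
  have hKc : (∫⁻ x in Ω, ‖a₁ x + b₂ x‖ₑ ^ (q / p)) ^ (1 / (q / p)) ≤ d 1 + d 2 := by
    rw [← eLpNorm_ofReal_eq _ (by positivity)]
    refine (eLpNorm_add_le ma₁ mb₂ ?_).trans (add_le_add ha₁ hb₂)
    rw [ENNReal.one_le_ofReal, one_le_div hp0]
    linarith
  have hKa : (∫⁻ x in Ω, ‖a₂ x‖ₑ ^ (r / p)) ^ (p / r) ≤ d 3 := by
    have := lintegral_rpow_le_eLpNorm_add_eLpNorm_top (f := a₂) (μ := volume.restrict Ω)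
      (r₀ := β / p) (r := r / p) (div_pos (by linarith) hp0) (by gcongr)
    rw [one_div_div] at this
    exact this.trans ha₂
  have hKb : (∫⁻ x in Ω, ‖b₃ x‖ₑ ^ (r / (p - 1))) ^ ((p - 1) / r) ≤ d 4 := by
    have := lintegral_rpow_le_eLpNorm_add_eLpNorm_top (f := b₃) (μ := volume.restrict Ω)
      (r₀ := β / (p - 1)) (r := r / (p - 1)) (div_pos (by linarith) hp1) (by gcongr)
    rw [one_div_div] at this
    exact this.trans hb₃
  have mu : AEMeasurable (fun x => ‖u x‖ₑ) (volume.restrict Ω) := hu.1.1.1.enorm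
  have hfin : ∫⁻ x in Ω, ‖u x‖ₑ ^ (χ * p) ≠ ⊤ := by
    have hc : 0 < criticalExponent N p := by linarith [one_lt_criticalExponent hp hpN]
    have := lintegral_rpow_enorm_lt_top_of_eLpNorm_lt_top (by simpa using hc)
      ENNReal.ofReal_ne_top hu.1.1.2
    rw [ENNReal.toReal_ofReal hc.le, ← hcrit] at this
    exact this.ne
  have key := moser_step (μ := volume.restrict Ω) (Q := q / p) (τ := τ) (r := r) hp hχ
    (by linarith) (by positivity) hτ0 hτ1 (by rw [hτdef, hχdef]; field_simp; ring) mu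
    (fun x => enorm_ne_top) (ma₁.add mb₂).enorm ma₂.enorm mb₃.enorm hKc hKa hKb hfin
    (fun k => lintegral_truncated_le hp hpN hlam hS hs ma₁ ma₂ mb₂ mb₃ (d 0).coe_nonneg hb hu
      (by linarith) k)
  rw [← eLpNorm_ofReal_eq _ hr0] at key
  change _ ≤ _ * max (normOn Ω (ENNReal.ofReal r) u)
    (normOn Ω (ENNReal.ofReal r) u ^ (1 - p / r)) ^ r at key
  set m := max (normOn Ω (ENNReal.ofReal r) u) (normOn Ω (ENNReal.ofReal r) u ^ (1 - p / r))
  -- The powers of `r` in the two summands of the constant are compared with `r ^ (p / (1 - τ))`.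
  have hconst : (2 * ((ENNReal.ofReal r * S) ^ p * ENNReal.ofReal (2 / lam)) * (d 1 + d 2)) ^
        (1 / (1 - τ)) + 2 * ((ENNReal.ofReal r * S) ^ p * ENNReal.ofReal (2 / lam)) *
        (ENNReal.ofReal (d 0 * (2 * d 0 / lam) ^ (p - 1)) + d 3 + d 4) ≤
      stepConst p lam τ S d * ENNReal.ofReal r ^ (p / (1 - τ)) := by
    have hR : 1 ≤ ENNReal.ofReal r := by rw [ENNReal.one_le_ofReal]; linarith
    have hRp : ENNReal.ofReal r ^ p ≤ ENNReal.ofReal r ^ (p / (1 - τ)) := by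
      refine ENNReal.rpow_le_rpow_of_exponent_le hR ?_
      rw [le_div_iff₀ hτ1']
      nlinarith
    have hCb : ENNReal.ofReal (d 0 * (2 * d 0 / lam) ^ (p - 1)) =
        d 0 * (d 0 * ((2 / lam).toNNReal : ℝ≥0∞)) ^ (p - 1) := by
      rw [ENNReal.ofReal_mul (d 0).coe_nonneg,
        ← ENNReal.ofReal_rpow_of_nonneg (by positivity) hp1.le, ENNReal.ofReal_coe_nnreal]
      congr 2
      rw [show 2 * (d 0 : ℝ) / lam = d 0 * (2 / lam) by ring, ENNReal.ofReal_mul (d 0).coe_nonneg,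
        ENNReal.ofReal_coe_nnreal]
      rfl
    have hcoe : (stepConst p lam τ S d : ℝ≥0∞) = 1 +
        ((2 * ((S : ℝ≥0∞) ^ p * ENNReal.ofReal (2 / lam)) * (d 1 + d 2)) ^ (1 / (1 - τ)) +
        2 * ((S : ℝ≥0∞) ^ p * ENNReal.ofReal (2 / lam)) *
          (ENNReal.ofReal (d 0 * (2 * d 0 / lam) ^ (p - 1)) + d 3 + d 4)) := by
      rw [hCb, stepConst]
      push_cast
      rw [ENNReal.coe_rpow_of_nonneg _ (by positivity), ENNReal.coe_rpow_of_nonneg _ hp1.le]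
      push_cast
      rw [ENNReal.coe_rpow_of_nonneg _ hp0.le]
      rfl
    rw [hcoe, ENNReal.mul_rpow_of_nonneg _ _ hp0.le]
    set R := ENNReal.ofReal r
    set s : ℝ≥0∞ := (S : ℝ≥0∞) ^ p * ENNReal.ofReal (2 / lam)
    rw [mul_assoc (R ^ p), show ∀ y : ℝ≥0∞, 2 * (R ^ p * s) * y = R ^ p * (2 * s * y) by
        intro y; ring, show ∀ y : ℝ≥0∞, 2 * (R ^ p * s) * y = R ^ p * (2 * s * y) by
        intro y; ring, ENNReal.mul_rpow_of_nonneg _ _ (by positivity), ← ENNReal.rpow_mul,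
      mul_one_div]
    refine le_trans (add_le_add le_rfl (mul_le_mul_left hRp _)) ?_
    rw [← mul_add, mul_comm]
    exact mul_le_mul_left le_add_self _
  have h1 := ENNReal.rpow_le_rpow (key.trans (mul_le_mul_left hconst _)) (z := 1 / r)
    (by positivity)
  rw [ENNReal.mul_rpow_of_nonneg _ _ (by positivity), ← ENNReal.rpow_mul, ← ENNReal.rpow_mul,
    mul_one_div_cancel hr0.ne', ENNReal.rpow_one, one_div_mul_one_div] at h1
  rw [normOn, eLpNorm_ofReal_eq _ (by positivity)]
  exact h1

end Quasilinear

theorem theorem2p1 (N : ℕ) (p β : ℝ) (hp : 1 < p) (hpN : p < (N : ℝ)) (hβ : p < β) :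
    -- `θ₀` depends on `p, β, N` only
    ∃ θ₀ : ℝ, 0 < θ₀ ∧ θ₀ ≤ 1 ∧
    ∀ q lam : ℝ, (N : ℝ) < q → 0 < lam →
    -- given `p, q, β, N, λ`, the constant `C` depends only on, and is nondecreasing in,
    -- the five norms of the data
    ∃ C : (Fin 5 → ℝ≥0) → ℝ≥0, Monotone C ∧
    ∀ (Ω : Set (Quasilinear.Space N))
      (A : Quasilinear.Space N → ℝ → Quasilinear.Space N → Quasilinear.Space N)
      (B : Quasilinear.Space N → ℝ → Quasilinear.Space N → ℝ)
      (a₁ a₂ b₁ b₂ b₃ : Quasilinear.Space N → ℝ)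
      (u : Quasilinear.Space N → ℝ) (g : Quasilinear.Space N → Quasilinear.Space N),
      Quasilinear.IsDomainSet Ω →
      Quasilinear.IsCaratheodory Ω A →
      Quasilinear.IsCaratheodory Ω B →
      Quasilinear.StructureConditions Ω p lam A B a₁ a₂ b₁ b₂ b₃ →
      MemLp b₁ ∞ (volume.restrict Ω) →
      MemLp a₁ (ENNReal.ofReal (q / p)) (volume.restrict Ω) →
      MemLp b₂ (ENNReal.ofReal (q / p)) (volume.restrict Ω) →
      MemLp a₂ (ENNReal.ofReal (β / p)) (volume.restrict Ω) →
      MemLp a₂ ∞ (volume.restrict Ω) →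
      MemLp b₃ (ENNReal.ofReal (β / (p - 1))) (volume.restrict Ω) →
      MemLp b₃ ∞ (volume.restrict Ω) →
      Quasilinear.IsWeakSolution Ω p A B u g →
      MemLp u (ENNReal.ofReal β) (volume.restrict Ω) →
      Quasilinear.normOn Ω ∞ u ≤
        (C ![(Quasilinear.normOn Ω ∞ b₁).toNNReal,
            (Quasilinear.normOn Ω (ENNReal.ofReal (q / p)) a₁).toNNReal,
            (Quasilinear.normOn Ω (ENNReal.ofReal (q / p)) b₂).toNNReal,
            (Quasilinear.interNormOn Ω (ENNReal.ofReal (β / p)) a₂).toNNReal,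
            (Quasilinear.interNormOn Ω (ENNReal.ofReal (β / (p - 1))) b₃).toNNReal] : ℝ≥0∞) *
          max (Quasilinear.normOn Ω (ENNReal.ofReal β) u)
            (Quasilinear.normOn Ω (ENNReal.ofReal β) u ^ θ₀) := by
  have hp0 : 0 < p := by linarith
  have hβ0 : 0 < β := by linarith
  have hN : 0 < (N : ℝ) := by linarith
  have hNp : 0 < (N : ℝ) - p := by linarith
  have hd0 : 0 < 1 - p / β := by rw [sub_pos, div_lt_one hβ0]; exact hβ
  have hd1 : 1 - p / β ≤ 1 := sub_le_self _ (by positivity)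
  set χ := (N : ℝ) / (N - p) with hχdef
  have hχ : 1 < χ := by rw [hχdef, one_lt_div hNp]; linarith
  have hχ0 : 0 < χ := by linarith
  have hχi : 0 < 1 - χ⁻¹ := sub_pos.2 (inv_lt_one_of_one_lt₀ hχ)
  obtain ⟨S, hS⟩ := Quasilinear.exists_sobolev hp hpN
  refine ⟨(1 - p / β) ^ (1 - χ⁻¹)⁻¹, Real.rpow_pos_of_pos hd0 _,
    Real.rpow_le_one hd0.le hd1 (by positivity), fun q lam hq hlam => ?_⟩
  have hq0 : 0 < q := by linarith
  have hτ1 : (N : ℝ) / q < 1 := by rw [div_lt_one hq0]; exact hq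
  set κ := p / (1 - N / q) with hκdef
  have hκ : 0 < κ := div_pos hp0 (by linarith)
  set E := ∑' i : ℕ, (1 + i : ℝ) / (β * χ ^ i) with hE
  have hE0 : 0 ≤ E := tsum_nonneg fun i => by positivity
  have hβχ : 1 ≤ ENNReal.ofReal (β * χ) := by
    rw [ENNReal.one_le_ofReal]; nlinarith
  refine ⟨fun d => (Quasilinear.stepConst p lam (N / q) S d * (β * χ).toNNReal ^ κ) ^ E, ?_, ?_⟩
  · intro d d' h
    exact NNReal.rpow_le_rpow (mul_le_mul_left
      (Quasilinear.monotone_stepConst S hp hτ1 h) _) hE0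
  intro Ω A B a₁ a₂ b₁ b₂ b₃ u g _ _ _ hs hb₁ ha₁ hb₂ ha₂ ha₂' hb₃ hb₃' hu _
  set d : Fin 5 → ℝ≥0 := ![(Quasilinear.normOn Ω ∞ b₁).toNNReal,
            (Quasilinear.normOn Ω (ENNReal.ofReal (q / p)) a₁).toNNReal,
            (Quasilinear.normOn Ω (ENNReal.ofReal (q / p)) b₂).toNNReal,
            (Quasilinear.interNormOn Ω (ENNReal.ofReal (β / p)) a₂).toNNReal,
            (Quasilinear.interNormOn Ω (ENNReal.ofReal (β / (p - 1))) b₃).toNNReal] with hd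
  have hr : Tendsto (fun j : ℕ => β * χ ^ j) atTop atTop :=
    (tendsto_pow_atTop_atTop_of_one_lt hχ).const_mul_atTop hβ0
  refine Quasilinear.eLpNorm_top_le_of_forall_eLpNorm_le hu.1.1.1 hr fun j => ?_
  set M := (Quasilinear.stepConst p lam (N / q) S d : ℝ≥0∞) with hM
  have hM1 : 1 ≤ M := by
    rw [hM]; exact_mod_cast Quasilinear.one_le_stepConst p lam (N / q) S d
  have hB1 : 1 ≤ M * ENNReal.ofReal (β * χ) ^ κ :=
    one_le_mul hM1 (ENNReal.one_le_rpow hβχ hκ)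
  have hC : (((Quasilinear.stepConst p lam (N / q) S d * (β * χ).toNNReal ^ κ) ^ E : ℝ≥0) :
      ℝ≥0∞) = (M * ENNReal.ofReal (β * χ) ^ κ) ^ E := by
    rw [ENNReal.coe_rpow_of_nonneg _ hE0, ENNReal.coe_mul, ENNReal.coe_rpow_of_nonneg _ hκ.le]
    rfl
  rw [hC]
  have key := Quasilinear.moser_recursion_bound (B := M * ENNReal.ofReal (β * χ) ^ κ)
    (a := fun j => Quasilinear.normOn Ω (ENNReal.ofReal (β * χ ^ j)) u) hp0 hβ hχ hB1 ?_ j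
  · simp only [pow_zero, mul_one] at key
    exact key
  intro j
  have hχj : 1 ≤ χ ^ j := one_le_pow₀ hχ.le
  have hrj : 0 < β * χ ^ j := by positivity
  have step := Quasilinear.eLpNorm_le_stepConst_mul (d := d) hp hpN hβ hq hlam hS hs
    ha₁.1 ha₂.1 hb₂.1 hb₃.1 (ENNReal.coe_toNNReal hb₁.2.ne).ge
    (ENNReal.coe_toNNReal ha₁.2.ne).ge (ENNReal.coe_toNNReal hb₂.2.ne).ge
    (ENNReal.coe_toNNReal (ENNReal.add_lt_top.2 ⟨ha₂.2, ha₂'.2⟩).ne).ge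
    (ENNReal.coe_toNNReal (ENNReal.add_lt_top.2 ⟨hb₃.2, hb₃'.2⟩).ne).ge hu
    (r := β * χ ^ j) (le_mul_of_one_le_right hβ0.le hχj)
  rw [← hχdef, show χ * (β * χ ^ j) = β * χ ^ (j + 1) by ring] at step
  refine step.trans (mul_le_mul_left ?_ _)
  -- `M (β χ ^ j) ^ κ ≤ (M (β χ) ^ κ) ^ (1 + j)`, since `M`, `β` and `χ` are at least `1`.
  rw [div_eq_mul_one_div (1 + j : ℝ), ENNReal.rpow_mul]
  refine ENNReal.rpow_le_rpow ?_ (by positivity)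
  rw [ENNReal.mul_rpow_of_nonneg _ _ (by positivity), ← ENNReal.rpow_mul, mul_comm κ,
    ENNReal.rpow_mul]
  refine mul_le_mul' ?_ (ENNReal.rpow_le_rpow ?_ hκ.le)
  · simpa using ENNReal.rpow_le_rpow_of_exponent_le hM1 (y := 1) (z := 1 + j)
      (le_add_of_nonneg_right j.cast_nonneg)
  · rw [ENNReal.ofReal_rpow_of_nonneg (by positivity) (by positivity)]
    refine ENNReal.ofReal_le_ofReal ?_
    rw [show (1 + j : ℝ) = ((j + 1 : ℕ) : ℝ) by push_cast; ring, Real.rpow_natCast, mul_pow,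
      pow_succ, pow_succ]
    have h1 : 1 ≤ β ^ j := one_le_pow₀ (by linarith)
    calc β * χ ^ j = (1 * β) * (χ ^ j * 1) := by ring
      _ ≤ (β ^ j * β) * (χ ^ j * χ) := by gcongr
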